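/- Let $S$ be a uniquely ergodic continuous map of a compact metric space $Y$, and let $\nu$ be its unique invariant Borel probability measure. Let $E_0\subset\mathbb S^1$ be the set of eigenvalues of $f\mapsto f\circ S$ on $L^2(Y,\nu)$, regarded as constant functions, and for $k\ge 1$ let $E_k$ be the set of all $f\in L^2(Y,\nu)$ with $|f|=1$ a.e. and $(f\circ S)/f\in E_{k-1}$. Assume that $(Y,\nu,S)$ has quasi-discrete spectrum, that is, $S^m$ is ergodic with respect to $\nu$ for every $m\ge 1$, and the linear span of $\bigcup_{k\ge 0}E_k$ is dense in $L^2(Y,\nu)$. Then, for every multiplicative function $\boldsymbol{\nu}:\mathbb N\to\mathbb C$ (i.e. $\boldsymbol\nu(1)=1$ and $\boldsymbol{\nu}(mn)=\boldsymbol{\nu}(m)\boldsymbol{\nu}(n)$ for coprime $m,n\geq 1$) with $|\boldsymbol\nu|\le 1$, every $f\in C(Y)$ with $\int_Y f\,d\nu=0$ and every $y\in Y$, $$\lim_{N\to\infty}\frac1N\sum_{1\le n\le N} f(S^ny)\,\boldsymbol{\nu}(n)=0 .$$ In particular, Sarnak's conjecture holds for $(Y,S)$: for every $f\in C(Y)$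 (with no condition on $\int_Y f\,d\nu$) and every $y\in Y$, $$\lim_{N\to\infty}\frac1N\sum_{1\le n\le N} f(S^ny)\,\boldsymbol{\mu}(n)=0,$$ where $\boldsymbol{\mu}$ is the Möbius function. -/

import Mathlib

open MeasureTheory

/-- `T` is uniquely ergodic: it has exactly one invariant probability measure. -/
def IsUniquelyErgodic {Y : Type*} [MeasurableSpace Y] (T : Y → Y) : Prop :=
  ∃! μ : Measure Y, IsProbabilityMeasure μ ∧ MeasurePreserving T μ μ

/-- All non-trivial powers of `T` are ergodic for `μ`. -/
def IsTotallyErgodic {X : Type*} [MeasurableSpace X] (T : X → X) (μ : Measure X) : Prop :=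
  ∀ m : ℕ, m ≠ 0 → Ergodic T^[m] μ

/-- `c` is an eigenvalue of the operator `f ↦ f ∘ T` on `L²(μ)`. -/
def IsKoopmanEigenvalue {X : Type*} [MeasurableSpace X] (T : X → X) (μ : Measure X) (c : ℂ) :
    Prop :=
  ∃ f : Lp ℂ 2 μ, f ≠ 0 ∧ (fun x => f (T x)) =ᵐ[μ] fun x => c * f x

/-- The sets `E_k(T)` in `L²(μ)`. `E_0(T)` consists of the eigenvalues of `T`, seen as constant
functions; `E_{k+1}(T)` consists of the `f` with `|f| = 1` such that `f ∘ T / f ∈ E_k(T)`. -/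
def quasiEigenfunctions {X : Type*} [MeasurableSpace X] (T : X → X) (μ : Measure X) :
    ℕ → Set (Lp ℂ 2 μ)
  | 0 => {g | ∃ c : ℂ, IsKoopmanEigenvalue T μ c ∧ g =ᵐ[μ] fun _ => c}
  | k + 1 => {f | (∀ᵐ x ∂μ, ‖f x‖ = 1) ∧
      ∃ g ∈ quasiEigenfunctions T μ k, (fun x => f (T x) / f x) =ᵐ[μ] g}

/-- `T` is totally ergodic and its quasi-eigenfunctions are linearly dense in `L²(μ)`. -/
structure HasQuasiDiscreteSpectrum {X : Type*} [MeasurableSpace X] (T : X → X) (μ : Measure X) :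
    Prop where
  totallyErgodic : IsTotallyErgodic T μ
  dense_span :
    (Submodule.span ℂ (⋃ k : ℕ, quasiEigenfunctions T μ k)).topologicalClosure = ⊤

/-! The Kátai–Bourgain–Sarnak–Ziegler criterion (`tendsto_average_mul_of_isMultiplicative`) reduces
the first claim to a statement without multiplicative functions: the averages of `f (S^[p * n] y)`
times the conjugate of `f (S^[q * n] y)` are eventually small for all large distinct primes `p`,
`q`. A limit of these averages is the integral of `f ⊗ conj f` against a measure `κ` invariant under
`S^[p] × S^[q]`. Total ergodicity makes the powers of `S` uniquely ergodic, so both marginals of `κ`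
are `ν`, and it is enough to bound the integral over all such joinings at once.

Up to a small `L²` error, a function of mean zero is a combination of phases: unimodular functions
some iterated multiplicative derivative of which is a constant `c`, here not a root of unity.
Passing from `S` to `S^[p]` turns the constant of a phase of degree `k` into `c ^ p ^ k`, so `g ⊗
conj h` is again a phase for `S^[p] × S^[q]`, and for large `p ≠ q` its constant is not a root of
unity. Such a phase has integral zero for every invariant probability measure
(`IsPhase.integral_eq_zero`). Hence the joinings see no correlation between the approximants.

For the Möbius function the mean of `f` need not vanish, and the constant part requires that `μ`
itself averages to zero. This form of the prime number theorem follows from the nonvanishing of `ζ`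
on `1 ≤ Re s` by a Tauberian argument with a Fourier kernel. -/

/-- `G` is a function of modulus one whose `k`-th multiplicative derivative along `R` is the
constant `c`, where the multiplicative derivative of `G` is `G ∘ R / G`. -/
def IsPhase {Z : Type*} [MeasurableSpace Z] (R : Z → Z) (κ : Measure Z) (c : ℂ) :
    ℕ → (Z → ℂ) → Prop
  | 0, G => ‖c‖ = 1 ∧ G =ᵐ[κ] fun _ => c
  | k + 1, G => AEStronglyMeasurable G κ ∧ (∀ᵐ z ∂κ, ‖G z‖ = 1) ∧
      ∃ G', IsPhase R κ c k G' ∧ G ∘ R =ᵐ[κ] G * G'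

/-! ### Calculus of phases -/

namespace IsPhase

variable {Z : Type*} [MeasurableSpace Z] {R : Z → Z} {κ : Measure Z} {c d : ℂ} {k : ℕ}
  {G H : Z → ℂ}

theorem aestronglyMeasurable (h : IsPhase R κ c k G) : AEStronglyMeasurable G κ := by
  cases k with
  | zero => exact aestronglyMeasurable_const.congr h.2.symm
  | succ k => exact h.1

theorem norm_eq_one (h : IsPhase R κ c k G) : ∀ᵐ z ∂κ, ‖G z‖ = 1 := by
  cases k with
  | zero => filter_upwards [h.2] with z hz using by rw [hz, h.1]
  | succ k => exact h.2.1

theorem norm_const_eq_one (h : IsPhase R κ c k G) : ‖c‖ = 1 := by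
  induction k generalizing G with
  | zero => exact h.1
  | succ k ih =>
    obtain ⟨-, -, G', hG', -⟩ := h
    exact ih hG'

theorem memLp [IsFiniteMeasure κ] (h : IsPhase R κ c k G) {p : ENNReal} : MemLp G p κ :=
  MemLp.of_bound h.aestronglyMeasurable 1 (h.norm_eq_one.mono fun _ hz => hz.le)

theorem mul (hG : IsPhase R κ c k G) (hH : IsPhase R κ d k H) : IsPhase R κ (c * d) k (G * H) := by
  induction k generalizing G H with
  | zero => exact ⟨by rw [norm_mul, hG.1, hH.1, one_mul], hG.2.mul hH.2⟩
  | succ k ih =>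
    obtain ⟨hGm, hG1, G', hG', hGe⟩ := hG
    obtain ⟨hHm, hH1, H', hH', hHe⟩ := hH
    refine ⟨hGm.mul hHm, ?_, G' * H', ih hG' hH', ?_⟩
    · filter_upwards [hG1, hH1] with z h1 h2 using by simp [h1, h2]
    · filter_upwards [hGe, hHe] with z h1 h2
      simp only [Function.comp_apply, Pi.mul_apply] at *
      rw [h1, h2]; ring

theorem conj (hG : IsPhase R κ c k G) :
    IsPhase R κ (starRingEnd ℂ c) k (fun z => starRingEnd ℂ (G z)) := by
  induction k generalizing G with
  | zero =>
    refine ⟨by rw [RCLike.norm_conj, hG.1], ?_⟩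
    filter_upwards [hG.2] with z hz using by rw [hz]
  | succ k ih =>
    obtain ⟨hGm, hG1, G', hG', hGe⟩ := hG
    refine ⟨Complex.continuous_conj.comp_aestronglyMeasurable hGm, ?_, _, ih hG', ?_⟩
    · filter_upwards [hG1] with z h1 using by rw [RCLike.norm_conj, h1]
    · filter_upwards [hGe] with z h1
      simp only [Function.comp_apply, Pi.mul_apply] at *
      rw [h1, map_mul]

theorem one (R : Z → Z) (κ : Measure Z) (k : ℕ) : IsPhase R κ 1 k 1 := by
  induction k with
  | zero => exact ⟨norm_one, Filter.EventuallyEq.rfl⟩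
  | succ k ih =>
    refine ⟨aestronglyMeasurable_one, by simp, 1, ih, ?_⟩
    exact Filter.Eventually.of_forall fun z => by simp

theorem prod {ι : Type*} (s : Finset ι) {G : ι → Z → ℂ} {c : ι → ℂ}
    (h : ∀ i ∈ s, IsPhase R κ (c i) k (G i)) : IsPhase R κ (∏ i ∈ s, c i) k (∏ i ∈ s, G i) := by
  classical
  induction s using Finset.induction_on with
  | empty => simpa using one R κ k
  | insert a s ha ih =>
    rw [Finset.prod_insert ha, Finset.prod_insert ha]
    exact (h a (Finset.mem_insert_self a s)).mul
      (ih fun i hi => h i (Finset.mem_insert_of_mem hi))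

/-- A phase of degree `k` is a phase of degree `k + 1` with trivial constant. -/
theorem succ (hG : IsPhase R κ c k G) (hR : Measure.QuasiMeasurePreserving R κ κ) :
    IsPhase R κ 1 (k + 1) G := by
  induction k generalizing G with
  | zero =>
    refine ⟨hG.aestronglyMeasurable, hG.norm_eq_one, 1, one R κ 0, ?_⟩
    have : G ∘ R =ᵐ[κ] fun _ => c := hR.ae_eq_comp hG.2
    filter_upwards [this, hG.2] with z h1 h2
    rw [h1, Pi.mul_apply, h2, Pi.one_apply, mul_one]
  | succ k ih =>
    obtain ⟨hGm, hG1, G', hG', hGe⟩ := hG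
    exact ⟨hGm, hG1, G', ih hG', hGe⟩

theorem of_lt (hG : IsPhase R κ c k G) (hR : Measure.QuasiMeasurePreserving R κ κ) {l : ℕ}
    (hl : k < l) : IsPhase R κ 1 l G := by
  induction l, hl using Nat.le_induction with
  | base => exact hG.succ hR
  | succ l _ ih => exact ih.succ hR

/-- Phases lift through factor maps. -/
theorem comp_factor {W : Type*} [MeasurableSpace W] {ν : Measure W} {T : W → W} {π : Z → W}
    {g : W → ℂ} (hg : IsPhase T ν c k g) (hπ : Measure.QuasiMeasurePreserving π κ ν)
    (hsemi : ∀ z, π (R z) = T (π z)) : IsPhase R κ c k (g ∘ π) := by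
  induction k generalizing g with
  | zero => exact ⟨hg.1, hπ.ae_eq_comp hg.2⟩
  | succ k ih =>
    obtain ⟨hm, h1, g', hg', he⟩ := hg
    refine ⟨hm.comp_quasiMeasurePreserving hπ, hπ.ae h1, g' ∘ π, ih hg', ?_⟩
    filter_upwards [hπ.ae_eq_comp he] with z hz
    simp only [Function.comp_apply, Pi.mul_apply, hsemi] at *
    exact hz

theorem comp_iterate (hG : IsPhase R κ c k G) (hR : Measure.QuasiMeasurePreserving R κ κ) (n : ℕ) :
    IsPhase R κ c k (G ∘ R^[n]) :=
  hG.comp_factor (hR.iterate n) fun z => by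
    rw [← Function.iterate_succ_apply, Function.iterate_succ_apply']

theorem comp_iterate_ae_eq {G' : Z → ℂ} (hR : Measure.QuasiMeasurePreserving R κ κ)
    (h : G ∘ R =ᵐ[κ] G * G') (n : ℕ) :
    G ∘ R^[n] =ᵐ[κ] G * ∏ i ∈ Finset.range n, G' ∘ R^[i] := by
  induction n with
  | zero => simp
  | succ n ih =>
    have h2 := (hR.iterate n).ae_eq_comp h
    filter_upwards [ih, h2] with z h1 h2
    simp only [Function.comp_apply, Pi.mul_apply, Finset.prod_apply, Finset.prod_range_succ,
      Function.iterate_succ_apply'] at *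
    rw [h2, h1]; ring

/-- The multiplicative derivative along `R^[n]` of a phase of degree `k + 1` for `R`. -/
theorem exists_comp_iterate (hG : IsPhase R κ c (k + 1) G)
    (hR : Measure.QuasiMeasurePreserving R κ κ) (n : ℕ) :
    ∃ H, IsPhase R κ (c ^ n) k H ∧ G ∘ R^[n] =ᵐ[κ] G * H := by
  obtain ⟨-, -, G', hG', he⟩ := hG
  refine ⟨_, ?_, comp_iterate_ae_eq hR he n⟩
  simpa using prod (Finset.range n) fun i _ => hG'.comp_iterate hR i

/-- A phase for `R` is a phase for the powers of `R`. -/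
theorem iterate (hG : IsPhase R κ c k G) (hR : Measure.QuasiMeasurePreserving R κ κ) (p : ℕ) :
    IsPhase R^[p] κ (c ^ p ^ k) k G := by
  induction k generalizing G with
  | zero => exact ⟨by simp [hG.1], by simpa using hG.2⟩
  | succ k ih =>
    obtain ⟨hm, h1, G', hG', he⟩ := hG
    -- The derivative along `R^[p]` is a product of `p` translates of `G'`, so each degree
    -- contributes one more `p`-th power of the constant.
    refine ⟨hm, h1, _, ?_, comp_iterate_ae_eq hR he p⟩
    simpa [pow_succ, pow_mul] using
      prod (Finset.range p) fun i _ => ih (hG'.comp_iterate hR i)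

/-- In degree one, `G ∘ R = c * G` with `c ≠ 1`, and invariance of `κ` kills the integral. In higher
degree the derivative of `G` along `R^[n]` has lower degree and constant `c ^ n`, so by induction
the functions `G ∘ R^[n]` are orthonormal. They all have the same inner product with `1`, which
Bessel's inequality forces to be zero. -/
theorem integral_eq_zero [IsProbabilityMeasure κ] (hR : MeasurePreserving R κ κ)
    (hG : IsPhase R κ c (k + 1) G) (hc : ∀ m : ℕ, m ≠ 0 → c ^ m ≠ 1) : ∫ z, G z ∂κ = 0 := by
  have hcomp : ∀ (F : Z → ℂ), AEStronglyMeasurable F κ → ∀ n, ∫ z, F (R^[n] z) ∂κ = ∫ z, F z ∂κ := by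
    intro F hF n
    have h := hR.iterate n
    rw [← integral_map h.measurable.aemeasurable (by rwa [h.map_eq]), h.map_eq]
  induction k generalizing G c with
  | zero =>
    obtain ⟨hm, h1, G', hG', he⟩ := hG
    have h2 : ∫ z, G (R z) ∂κ = c * ∫ z, G z ∂κ := by
      rw [← integral_const_mul]
      refine integral_congr_ae ?_
      filter_upwards [he, hG'.2] with z hz hz'
      simp only [Function.comp_apply, Pi.mul_apply] at hz
      rw [hz, hz', mul_comm]
    have h3 : ∫ z, G (R z) ∂κ = ∫ z, G z ∂κ := hcomp G hm 1
    rw [h3] at h2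
    have h4 : (1 - c) * ∫ z, G z ∂κ = 0 := by linear_combination h2
    refine (mul_eq_zero.mp h4).resolve_left fun h => hc 1 one_ne_zero ?_
    rw [pow_one]; exact (sub_eq_zero.mp h).symm
  | succ k ih =>
    have hq := hR.quasiMeasurePreserving
    have hGn := fun n => hG.comp_iterate hq n
    have hL := fun n => (hGn n).memLp (p := 2)
    have hmul : ∀ n : ℕ, n ≠ 0 → ∫ z, G (R^[n] z) * starRingEnd ℂ (G z) ∂κ = 0 := by
      intro n hn
      obtain ⟨H, hH, he⟩ := hG.exists_comp_iterate hq n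
      rw [← ih hH fun m hm => by rw [← pow_mul]; exact hc _ (mul_ne_zero hn hm)]
      refine integral_congr_ae ?_
      filter_upwards [he, hG.norm_eq_one] with z hz hz1
      simp only [Function.comp_apply, Pi.mul_apply] at hz
      have : G z * starRingEnd ℂ (G z) = 1 := by
        rw [RCLike.mul_conj, hz1]; simp
      rw [hz]; linear_combination H z * this
    have hinner : ∀ m n, inner ℂ ((hL m).toLp _) ((hL n).toLp _) =
        ∫ z, G (R^[n] z) * starRingEnd ℂ (G (R^[m] z)) ∂κ := by
      intro m n
      rw [L2.inner_def]
      refine integral_congr_ae ?_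
      filter_upwards [(hL m).coeFn_toLp, (hL n).coeFn_toLp] with z h1 h2
      rw [h1, h2]; rfl
    have hlt : ∀ m n, m < n → inner ℂ ((hL m).toLp _) ((hL n).toLp _) = 0 := by
      intro m n hmn
      rw [hinner]
      obtain ⟨r, rfl⟩ := Nat.exists_eq_add_of_lt hmn
      have h1 := hcomp (fun z => G (R^[r + 1] z) * starRingEnd ℂ (G z))
        ((hGn _).aestronglyMeasurable.mul
          (Complex.continuous_conj.comp_aestronglyMeasurable hG.aestronglyMeasurable)) m
      rw [hmul _ r.succ_ne_zero] at h1
      rw [← h1]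
      simp only [← Function.iterate_add_apply]
      rw [show r + 1 + m = m + r + 1 by ring]
    have hort : Orthonormal ℂ fun n => (hL n).toLp _ := by
      refine ⟨fun n => ?_, fun m n hmn => ?_⟩
      · have h1 : inner ℂ ((hL n).toLp _) ((hL n).toLp _) = 1 := by
          rw [hinner]
          have : (fun z => G (R^[n] z) * starRingEnd ℂ (G (R^[n] z))) =ᵐ[κ] fun _ => 1 := by
            filter_upwards [(hGn n).norm_eq_one] with z hz
            simp only [Function.comp_apply] at hz
            rw [RCLike.mul_conj, hz]; simp
          rw [integral_congr_ae this]; simp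
        rw [norm_eq_sqrt_re_inner (𝕜 := ℂ), h1]; simp
      · rcases lt_or_gt_of_ne hmn with h | h
        · exact hlt m n h
        · rw [← inner_conj_symm, hlt n m h, map_zero]
    have h1L : MemLp (fun _ : Z => (1 : ℂ)) 2 κ := memLp_const 1
    have hone : ∀ n, inner ℂ ((hL n).toLp _) (h1L.toLp _) = starRingEnd ℂ (∫ z, G z ∂κ) := by
      intro n
      rw [← hcomp G hG.aestronglyMeasurable n, L2.inner_def, ← integral_conj]
      refine integral_congr_ae ?_
      filter_upwards [(hL n).coeFn_toLp, h1L.coeFn_toLp] with z h1 h2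
      rw [h1, h2]; simp
    have hs := hort.inner_products_summable (h1L.toLp _)
    simp only [hone, summable_const_iff] at hs
    simpa using hs

end IsPhase

/-! ### Joinings of `S^[p]` and `S^[q]` -/

/-- For numbers `c`, `d` that are not roots of unity, `c ^ p ^ k / d ^ q ^ k` is not a root of unity
for distinct large primes `p`, `q`. -/
theorem exists_forall_prime_pow_mul_conj_pow_ne_one {c d : ℂ} (hc0 : c ≠ 0) (hd1 : ‖d‖ = 1)
    (hc : ∀ m : ℕ, m ≠ 0 → c ^ m ≠ 1) {k : ℕ} (hk : k ≠ 0) :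
    ∃ K : ℕ, ∀ p q : ℕ, p.Prime → q.Prime → p ≠ q → K < p → K < q → ∀ m : ℕ, m ≠ 0 →
      (c ^ p ^ k * starRingEnd ℂ d ^ q ^ k) ^ m ≠ 1 := by
  have hdd : d * starRingEnd ℂ d = 1 := by rw [RCLike.mul_conj, hd1]; simp
  have key : ∀ p q m : ℕ, (c ^ p ^ k * starRingEnd ℂ d ^ q ^ k) ^ m = 1 →
      c ^ (p ^ k * m) = d ^ (q ^ k * m) := by
    intro p q m h
    calc c ^ (p ^ k * m) = (c ^ p ^ k * starRingEnd ℂ d ^ q ^ k) ^ m *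
          (d ^ (q ^ k * m)) := by
          rw [mul_pow, ← pow_mul, ← pow_mul, mul_assoc, ← mul_pow, mul_comm _ d, hdd, one_pow,
            mul_one]
      _ = _ := by rw [h, one_mul]
  have hinj : ∀ a b : ℕ, c ^ a = c ^ b → a = b := by
    have : ∀ a b : ℕ, a < b → c ^ a ≠ c ^ b := by
      intro a b hab h
      refine hc (b - a) (by omega) (mul_left_cancel₀ (pow_ne_zero a hc0) ?_)
      rw [← pow_add, Nat.add_sub_cancel' hab.le, h, mul_one]
    intro a b h
    rcases lt_trichotomy a b with h1 | h1 | h1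
    · exact absurd h (this a b h1)
    · exact h1
    · exact absurd h.symm (this b a h1)
  -- Two exceptional pairs, with `p` beyond `p₀`, give two multiplicative relations between `c` and
  -- `d`. Eliminating `d` yields `p * q₀ = p₀ * q`, so `p` divides `p₀` or `q`, and both are
  -- impossible.
  by_contra! hcon
  obtain ⟨p₀, q₀, hp₀, hq₀, hne₀, -, -, m₀, hm₀, h₀⟩ := hcon 0
  obtain ⟨p, q, hp, hq, hne, hlt, -, m, hm, h⟩ := hcon p₀
  have e₀ := key _ _ _ h₀
  have e := key _ _ _ h
  have h1 : c ^ (p ^ k * m * (q₀ ^ k * m₀)) = c ^ (p₀ ^ k * m₀ * (q ^ k * m)) := by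
    rw [pow_mul, e, pow_mul c, e₀, ← pow_mul, ← pow_mul, mul_comm]
  have h2 := hinj _ _ h1
  have h3 : (p * q₀) ^ k = (p₀ * q) ^ k := by
    have : (p * q₀) ^ k * (m * m₀) = (p₀ * q) ^ k * (m * m₀) := by
      rw [mul_pow, mul_pow]; linear_combination h2
    exact Nat.eq_of_mul_eq_mul_right (Nat.mul_pos (by omega) (by omega)) this
  have h4 : p * q₀ = p₀ * q := Nat.pow_left_injective hk h3
  rcases (Nat.Prime.dvd_mul hp).mp (Dvd.intro _ h4) with h5 | h5
  · exact absurd (Nat.le_of_dvd hp₀.pos h5) (by omega)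
  · exact hne ((Nat.prime_dvd_prime_iff_eq hp hq).mp h5)

section Joinings

variable {Y : Type*} [MeasurableSpace Y] {S : Y → Y} {ν : Measure Y}

/-- The elements of `L²` that are phases of positive degree whose constant is not a root of
unity. -/
def nontrivialPhases (S : Y → Y) (ν : Measure Y) : Set (Lp ℂ 2 ν) :=
  {g | ∃ (k : ℕ) (c : ℂ), (∀ m : ℕ, m ≠ 0 → c ^ m ≠ 1) ∧ IsPhase S ν c (k + 1) g}

/-- Induction on the degree; the only case of interest is a derivative equal to a constant `a`. If
`a` is not a root of unity, `g` is a phase of degree one. If `a ^ m = 1`, then `g` is invariant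
under `S^[m]`, hence constant by total ergodicity. -/
theorem mem_nontrivialPhases_or_ae_const [IsProbabilityMeasure ν] (hS : IsTotallyErgodic S ν)
    {k : ℕ} {g : Lp ℂ 2 ν} (hg : g ∈ quasiEigenfunctions S ν k) :
    g ∈ nontrivialPhases S ν ∨ ∃ a : ℂ, g =ᵐ[ν] fun _ => a := by
  induction k generalizing g with
  | zero =>
    obtain ⟨c, -, hc⟩ := hg
    exact Or.inr ⟨c, hc⟩
  | succ k ih =>
    have hq : Measure.QuasiMeasurePreserving S ν ν := by
      simpa using (hS 1 one_ne_zero).quasiMeasurePreserving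
    obtain ⟨h1, g', hg', he⟩ := hg
    have he' : g ∘ S =ᵐ[ν] g * g' := by
      filter_upwards [h1, he] with x hx hx'
      have : g x ≠ 0 := by rw [← norm_ne_zero_iff, hx]; exact one_ne_zero
      rw [Pi.mul_apply, ← hx', Function.comp_apply]
      field_simp
    rcases ih hg' with ⟨l, c, hc, hp⟩ | ⟨a, ha⟩
    · exact Or.inl ⟨l + 1, c, hc, Lp.aestronglyMeasurable g, h1, g', hp, he'⟩
    · by_cases hroot : ∀ m : ℕ, m ≠ 0 → a ^ m ≠ 1
      · refine Or.inl ⟨0, a, hroot, Lp.aestronglyMeasurable g, h1, g', ⟨?_, ha⟩, he'⟩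
        have : ∀ᵐ x ∂ν, ‖a‖ = 1 := by
          filter_upwards [h1, hq.ae h1, he', ha] with x h1 h2 h3 h4
          simp only [Function.comp_apply, Pi.mul_apply] at h3
          rw [h3, norm_mul, h1, one_mul, h4] at h2
          exact h2
        simpa using this
      · push Not at hroot
        obtain ⟨m, hm, ham⟩ := hroot
        right
        refine (hS m hm).ae_eq_const_of_ae_eq_comp_ae (Lp.aestronglyMeasurable g) ?_
        have hall : ∀ᵐ x ∂ν, ∀ i, g' (S^[i] x) = a :=
          ae_all_iff.mpr fun i => (hq.iterate i).ae ha
        filter_upwards [IsPhase.comp_iterate_ae_eq hq he' m, hall] with x hx hx'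
        rw [hx, Pi.mul_apply, Finset.prod_apply]
        simp [hx', ham]

theorem inner_one_nontrivialPhases [IsProbabilityMeasure ν] (hS : MeasurePreserving S ν ν)
    {g : Lp ℂ 2 ν} (hg : g ∈ nontrivialPhases S ν) :
    inner ℂ ((memLp_const (1 : ℂ)).toLp _ : Lp ℂ 2 ν) g = 0 := by
  obtain ⟨k, c, hc, hp⟩ := hg
  rw [L2.inner_def, ← hp.integral_eq_zero hS hc]
  refine integral_congr_ae ?_
  filter_upwards [(memLp_const (1 : ℂ) : MemLp (fun _ : Y => (1 : ℂ)) 2 ν).coeFn_toLp] with x hx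
  rw [hx]; simp

/-- Functions orthogonal to the constants are approximated by combinations of nontrivial phases. -/
theorem exists_mem_span_nontrivialPhases [IsProbabilityMeasure ν] (hS : MeasurePreserving S ν ν)
    (hq : HasQuasiDiscreteSpectrum S ν) {f : Lp ℂ 2 ν}
    (hf : inner ℂ ((memLp_const (1 : ℂ)).toLp _ : Lp ℂ 2 ν) f = 0) {ε : ℝ} (hε : 0 < ε) :
    ∃ w ∈ Submodule.span ℂ (nontrivialPhases S ν), ‖f - w‖ < ε := by
  set e : Lp ℂ 2 ν := (memLp_const (1 : ℂ)).toLp _ with he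
  have hmem : f ∈ (Submodule.span ℂ (⋃ k : ℕ, quasiEigenfunctions S ν k)).topologicalClosure := by
    rw [hq.dense_span]; trivial
  obtain ⟨v, hv, hfv⟩ := Metric.mem_closure_iff.mp
    (by simpa [← Submodule.topologicalClosure_coe] using hmem :
      f ∈ closure (Submodule.span ℂ (⋃ k : ℕ, quasiEigenfunctions S ν k) : Set (Lp ℂ 2 ν))) ε hε
  have hle : Submodule.span ℂ (⋃ k : ℕ, quasiEigenfunctions S ν k) ≤
      Submodule.span ℂ (nontrivialPhases S ν) ⊔ Submodule.span ℂ {e} := by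
    refine Submodule.span_le.mpr ?_
    rintro g hg
    obtain ⟨k, hg⟩ := Set.mem_iUnion.mp hg
    rcases mem_nontrivialPhases_or_ae_const hq.totallyErgodic hg with h | ⟨a, ha⟩
    · exact Submodule.mem_sup_left (Submodule.subset_span h)
    · refine Submodule.mem_sup_right (Submodule.mem_span_singleton.mpr ⟨a, ?_⟩)
      refine Lp.ext ?_
      filter_upwards [ha, Lp.coeFn_smul a e,
        (memLp_const (1 : ℂ) : MemLp (fun _ : Y => (1 : ℂ)) 2 ν).coeFn_toLp] with x h1 h2 h3
      rw [h1, h2, Pi.smul_apply, he, h3]; simp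
  obtain ⟨w, hw, b, hb, rfl⟩ := Submodule.mem_sup.mp (hle hv)
  obtain ⟨a, rfl⟩ := Submodule.mem_span_singleton.mp hb
  refine ⟨w, hw, lt_of_le_of_lt ?_ hfv⟩
  have hw0 : inner ℂ e w = 0 := by
    clear hfv hv
    induction hw using Submodule.span_induction with
    | mem g hg => exact inner_one_nontrivialPhases hS hg
    | zero => exact inner_zero_right _
    | add x y _ _ hx hy => rw [inner_add_right, hx, hy, add_zero]
    | smul a x _ hx => rw [inner_smul_right, hx, mul_zero]
  -- Both `f` and `w` are orthogonal to the constants, so by Pythagoras dropping the constant part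
  -- of the approximant does not increase the error.
  have hort : inner ℂ (f - w) (-(a • e)) = 0 := by
    rw [inner_neg_right, inner_smul_right, ← inner_conj_symm, inner_sub_right, hf, hw0]
    simp
  have hpyth := norm_add_sq_eq_norm_sq_add_norm_sq_of_inner_eq_zero (𝕜 := ℂ) _ _ hort
  rw [dist_eq_norm, show f - (w + a • e) = f - w + -(a • e) by abel]
  exact abs_le_of_sq_le_sq' (by nlinarith [norm_nonneg (-(a • e))]) (norm_nonneg _) |>.2

/-- The product `g ⊗ conj h` is a phase for `S^[p] × S^[q]`. If the degrees differ, the factor of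
smaller degree has trivial constant in the larger degree, and only the other constant matters. If
they agree, the constants combine, and it takes large distinct primes to avoid roots of unity. The
threshold depends on `g` and `h` only, not on `κ`. -/
theorem inner_comp_fst_snd_eq_zero_of_mem_nontrivialPhases (hS : MeasurePreserving S ν ν)
    {g h : Lp ℂ 2 ν} (hg : g ∈ nontrivialPhases S ν) (hh : h ∈ nontrivialPhases S ν) :
    ∃ K : ℕ, ∀ p q : ℕ, p.Prime → q.Prime → p ≠ q → K < p → K < q →
      ∀ κ : Measure (Y × Y), IsProbabilityMeasure κ →
      MeasurePreserving (Prod.map S^[p] S^[q]) κ κ →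
      ∀ (h₁ : MeasurePreserving Prod.fst κ ν) (h₂ : MeasurePreserving Prod.snd κ ν),
      inner ℂ (Lp.compMeasurePreservingₗᵢ ℂ _ h₂ h) (Lp.compMeasurePreservingₗᵢ ℂ _ h₁ g) = 0 := by
  obtain ⟨k, c, hc, hg⟩ := hg
  obtain ⟨l, d, hd, hh⟩ := hh
  have hq := hS.quasiMeasurePreserving
  suffices hsuff : ∃ K : ℕ, ∀ p q : ℕ, p.Prime → q.Prime → p ≠ q → K < p → K < q →
      ∀ κ : Measure (Y × Y), MeasurePreserving (Prod.map S^[p] S^[q]) κ κ →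
      MeasurePreserving Prod.fst κ ν → MeasurePreserving Prod.snd κ ν → ∃ (j : ℕ) (a : ℂ),
      (∀ m : ℕ, m ≠ 0 → a ^ m ≠ 1) ∧
      IsPhase (Prod.map S^[p] S^[q]) κ a (j + 1)
        ((g ∘ Prod.fst) * fun z => starRingEnd ℂ (h z.2)) by
    obtain ⟨K, hK⟩ := hsuff
    refine ⟨K, fun p q hp hq' hne hKp hKq κ _ hR h₁ h₂ => ?_⟩
    obtain ⟨j, a, ha, hphase⟩ := hK p q hp hq' hne hKp hKq κ hR h₁ h₂
    rw [L2.inner_def, ← hphase.integral_eq_zero hR ha]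
    refine integral_congr_ae ?_
    filter_upwards [Lp.coeFn_compMeasurePreserving g h₁, Lp.coeFn_compMeasurePreserving h h₂]
      with z h1 h2
    change inner ℂ ((Lp.compMeasurePreserving _ h₂ h : Lp ℂ 2 κ) z)
      ((Lp.compMeasurePreserving _ h₁ g : Lp ℂ 2 κ) z) = _
    rw [h1, h2]
    rfl
  have lift : ∀ p q : ℕ, ∀ κ : Measure (Y × Y), MeasurePreserving Prod.fst κ ν →
      MeasurePreserving Prod.snd κ ν →
      IsPhase (Prod.map S^[p] S^[q]) κ (c ^ p ^ (k + 1)) (k + 1) (g ∘ Prod.fst) ∧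
      IsPhase (Prod.map S^[p] S^[q]) κ (starRingEnd ℂ d ^ q ^ (l + 1)) (l + 1)
        (fun z => starRingEnd ℂ (h z.2)) := by
    intro p q κ h₁ h₂
    exact ⟨(hg.iterate hq p).comp_factor h₁.quasiMeasurePreserving fun z => rfl,
      (hh.conj.iterate hq q).comp_factor h₂.quasiMeasurePreserving fun z => rfl⟩
  rcases lt_trichotomy k l with hkl | rfl | hkl
  · refine ⟨0, fun p q hp hq' hne hKp hKq κ hR h₁ h₂ => ⟨l, starRingEnd ℂ d ^ q ^ (l + 1), ?_, ?_⟩⟩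
    · intro m hm
      rw [← pow_mul, ← map_pow]
      intro h
      refine hd (q ^ (l + 1) * m) (mul_ne_zero (pow_ne_zero _ hq'.ne_zero) hm) ?_
      simpa using congrArg (starRingEnd ℂ) h
    · obtain ⟨h3, h4⟩ := lift p q κ h₁ h₂
      simpa using (h3.of_lt hR.quasiMeasurePreserving (Nat.succ_lt_succ hkl)).mul h4
  · obtain ⟨K, hK⟩ := exists_forall_prime_pow_mul_conj_pow_ne_one
      (norm_ne_zero_iff.mp (by rw [hg.norm_const_eq_one]; exact one_ne_zero)) hh.norm_const_eq_one hc
      (Nat.succ_ne_zero k)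
    refine ⟨K, fun p q hp hq' hne hKp hKq κ hR h₁ h₂ =>
      ⟨k, _, hK p q hp hq' hne hKp hKq, ?_⟩⟩
    obtain ⟨h3, h4⟩ := lift p q κ h₁ h₂
    exact h3.mul h4
  · refine ⟨0, fun p q hp hq' hne hKp hKq κ hR h₁ h₂ => ⟨k, c ^ p ^ (k + 1), ?_, ?_⟩⟩
    · intro m hm
      rw [← pow_mul]
      exact hc _ (mul_ne_zero (pow_ne_zero _ hp.ne_zero) hm)
    · obtain ⟨h3, h4⟩ := lift p q κ h₁ h₂
      simpa using h3.mul (h4.of_lt hR.quasiMeasurePreserving (Nat.succ_lt_succ hkl))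

theorem inner_comp_fst_snd_eq_zero_of_mem_span (hS : MeasurePreserving S ν ν)
    {g h : Lp ℂ 2 ν} (hg : g ∈ Submodule.span ℂ (nontrivialPhases S ν))
    (hh : h ∈ Submodule.span ℂ (nontrivialPhases S ν)) :
    ∃ K : ℕ, ∀ p q : ℕ, p.Prime → q.Prime → p ≠ q → K < p → K < q →
      ∀ κ : Measure (Y × Y), IsProbabilityMeasure κ →
      MeasurePreserving (Prod.map S^[p] S^[q]) κ κ →
      ∀ (h₁ : MeasurePreserving Prod.fst κ ν) (h₂ : MeasurePreserving Prod.snd κ ν),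
      inner ℂ (Lp.compMeasurePreservingₗᵢ ℂ _ h₂ h) (Lp.compMeasurePreservingₗᵢ ℂ _ h₁ g) = 0 := by
  induction hg, hh using Submodule.span_induction₂ with
  | mem_mem x y hx hy => exact inner_comp_fst_snd_eq_zero_of_mem_nontrivialPhases hS hx hy
  | zero_left y _ => exact ⟨0, by intros; rw [map_zero, inner_zero_right]⟩
  | zero_right x _ => exact ⟨0, by intros; rw [map_zero, inner_zero_left]⟩
  | add_left x y z _ _ _ hx hy =>
    obtain ⟨K, hK⟩ := hx
    obtain ⟨L, hL⟩ := hy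
    refine ⟨max K L, fun p q hp hq hne hKp hKq κ hκ hR h₁ h₂ => ?_⟩
    rw [max_lt_iff] at hKp hKq
    rw [map_add, inner_add_right, hK p q hp hq hne hKp.1 hKq.1 κ hκ hR h₁ h₂,
      hL p q hp hq hne hKp.2 hKq.2 κ hκ hR h₁ h₂, add_zero]
  | add_right x y z _ _ _ hx hy =>
    obtain ⟨K, hK⟩ := hx
    obtain ⟨L, hL⟩ := hy
    refine ⟨max K L, fun p q hp hq hne hKp hKq κ hκ hR h₁ h₂ => ?_⟩
    rw [max_lt_iff] at hKp hKq
    rw [map_add, inner_add_left, hK p q hp hq hne hKp.1 hKq.1 κ hκ hR h₁ h₂,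
      hL p q hp hq hne hKp.2 hKq.2 κ hκ hR h₁ h₂, add_zero]
  | smul_left a x y _ _ hx =>
    obtain ⟨K, hK⟩ := hx
    refine ⟨K, fun p q hp hq hne hKp hKq κ hκ hR h₁ h₂ => ?_⟩
    rw [map_smul, inner_smul_right, hK p q hp hq hne hKp hKq κ hκ hR h₁ h₂, mul_zero]
  | smul_right a x y _ _ hx =>
    obtain ⟨K, hK⟩ := hx
    refine ⟨K, fun p q hp hq hne hKp hKq κ hκ hR h₁ h₂ => ?_⟩
    rw [map_smul, inner_smul_left, hK p q hp hq hne hKp hKq κ hκ hR h₁ h₂, mul_zero]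

/-- Large distinct prime powers of a map with quasi-discrete spectrum are asymptotically
orthogonal. -/
theorem norm_inner_comp_fst_snd_le [IsProbabilityMeasure ν] (hS : MeasurePreserving S ν ν)
    (hqds : HasQuasiDiscreteSpectrum S ν) {f : Lp ℂ 2 ν}
    (hf : inner ℂ ((memLp_const (1 : ℂ)).toLp _ : Lp ℂ 2 ν) f = 0) {ε : ℝ} (hε : 0 < ε) :
    ∃ K : ℕ, ∀ p q : ℕ, p.Prime → q.Prime → p ≠ q → K < p → K < q →
      ∀ κ : Measure (Y × Y), IsProbabilityMeasure κ →
      MeasurePreserving (Prod.map S^[p] S^[q]) κ κ →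
      ∀ (h₁ : MeasurePreserving Prod.fst κ ν) (h₂ : MeasurePreserving Prod.snd κ ν),
      ‖inner ℂ (Lp.compMeasurePreservingₗᵢ ℂ _ h₂ f) (Lp.compMeasurePreservingₗᵢ ℂ _ h₁ f)‖ ≤ ε := by
  -- Replacing both copies of `f` by `w` costs at most `δ * ‖f‖ + δ * ‖w‖`; the bound `δ ≤ 1` gives
  -- `‖w‖ ≤ ‖f‖ + 1`.
  set δ : ℝ := min 1 (ε / (2 * ‖f‖ + 1)) with hδ
  have hpos : 0 < 2 * ‖f‖ + 1 := by positivity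
  have hδ0 : 0 < δ := lt_min one_pos (div_pos hε hpos)
  obtain ⟨w, hw, hfw⟩ := exists_mem_span_nontrivialPhases hS hqds hf hδ0
  obtain ⟨K, hK⟩ := inner_comp_fst_snd_eq_zero_of_mem_span hS hw hw
  refine ⟨K, fun p q hp hq hne hKp hKq κ hκ hR h₁ h₂ => ?_⟩
  have h0 := hK p q hp hq hne hKp hKq κ hκ hR h₁ h₂
  set U := Lp.compMeasurePreservingₗᵢ (E := ℂ) (p := 2) ℂ _ h₁
  set V := Lp.compMeasurePreservingₗᵢ (E := ℂ) (p := 2) ℂ _ h₂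
  have hsplit : inner ℂ (V f) (U f) = inner ℂ (V (f - w)) (U f) + inner ℂ (V w) (U (f - w)) := by
    rw [map_sub, map_sub, inner_sub_left, inner_sub_right, h0]; ring
  have hwn : ‖w‖ ≤ ‖f‖ + 1 := by
    have h1 : ‖w‖ ≤ ‖f‖ + ‖f - w‖ := by
      rw [← norm_neg (f - w), neg_sub]
      simpa using norm_add_le f (w - f)
    have h2 : δ ≤ 1 := min_le_left _ _
    linarith
  have hδε : δ * (2 * ‖f‖ + 1) ≤ ε := by
    rw [← le_div_iff₀ hpos]; exact min_le_right _ _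
  rw [hsplit]
  calc _ ≤ ‖V (f - w)‖ * ‖U f‖ + ‖V w‖ * ‖U (f - w)‖ :=
        (norm_add_le _ _).trans (add_le_add (norm_inner_le_norm _ _) (norm_inner_le_norm _ _))
    _ ≤ δ * ‖f‖ + (‖f‖ + 1) * δ := by
        simp only [LinearIsometry.norm_map]
        gcongr
    _ ≤ ε := by linarith

end Joinings

/-! ### Empirical measures along orbits and unique ergodicity of powers -/

open Filter Topology in
/-- Krylov–Bogolyubov: along any ultrafilter the empirical measures of an orbit converge weakly to
an invariant probability measure. -/
theorem exists_measurePreserving_tendsto_average {Z : Type*} [MetricSpace Z] [CompactSpace Z]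
    [MeasurableSpace Z] [BorelSpace Z] {R : Z → Z} (hR : Continuous R) (z : Z)
    (U : Ultrafilter ℕ) (hU : (U : Filter ℕ) ≤ atTop) :
    ∃ κ : Measure Z, IsProbabilityMeasure κ ∧ MeasurePreserving R κ κ ∧
      ∀ φ : Z → ℂ, Continuous φ → Tendsto
        (fun N : ℕ => (1 / (N : ℂ)) * ∑ n ∈ Finset.Icc 1 N, φ (R^[n] z)) U (𝓝 (∫ x, φ x ∂κ)) := by
  -- The guard `max N 1` keeps the term at `N = 0` a probability measure.
  let μ : ℕ → Measure Z := fun N =>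
    ((max N 1 : ℕ) : ENNReal)⁻¹ • ∑ n ∈ Finset.Icc 1 (max N 1), Measure.dirac (R^[n] z)
  have hμ : ∀ N, IsProbabilityMeasure (μ N) := fun N => ⟨by
    simp only [μ, Measure.smul_apply, Measure.finsetSum_apply, measure_univ, Finset.sum_const,
      Nat.card_Icc, add_tsub_cancel_right, smul_eq_mul, nsmul_eq_mul, mul_one]
    exact ENNReal.inv_mul_cancel (by exact_mod_cast (by omega : max N 1 ≠ 0))
      (ENNReal.natCast_ne_top _)⟩
  have hint : ∀ N, N ≠ 0 → ∀ φ : Z → ℂ, ∫ x, φ x ∂(μ N) =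
      (1 / (N : ℂ)) * ∑ n ∈ Finset.Icc 1 N, φ (R^[n] z) := by
    intro N hN φ
    have hN' : max N 1 = N := by omega
    simp only [μ, hN']
    rw [integral_smul_measure, integral_finsetSum_measure fun i _ => integrable_dirac (by simp)]
    simp [Complex.real_smul]
  let P : ℕ → ProbabilityMeasure Z := fun N => ⟨μ N, hμ N⟩
  obtain ⟨κ, hκ⟩ : ∃ κ : ProbabilityMeasure Z, Tendsto P U (𝓝 κ) := by
    obtain ⟨κ, -, hκ⟩ := isCompact_univ.ultrafilter_le_nhds (U.map P) (by simp)
    exact ⟨κ, hκ⟩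
  have hlim : ∀ φ : Z → ℂ, Continuous φ → Tendsto
      (fun N : ℕ => (1 / (N : ℂ)) * ∑ n ∈ Finset.Icc 1 N, φ (R^[n] z)) U
      (𝓝 (∫ x, φ x ∂(κ : Measure Z))) := by
    intro φ hφ
    have h := (ProbabilityMeasure.tendsto_iff_forall_integral_rclike_tendsto ℂ).mp hκ
      (BoundedContinuousFunction.mkOfCompact ⟨φ, hφ⟩)
    refine h.congr' ?_
    filter_upwards [hU (eventually_ne_atTop 0)] with N hN
    exact hint N hN φ
  refine ⟨κ, inferInstance, ⟨hR.measurable, ?_⟩, hlim⟩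
  have := Measure.isProbabilityMeasure_map (μ := (κ : Measure Z)) hR.measurable.aemeasurable
  refine ext_of_forall_integral_eq_of_IsFiniteMeasure fun φ => ?_
  rw [integral_map hR.measurable.aemeasurable φ.continuous.aestronglyMeasurable]
  have h1 := hlim (fun x => (φ (R x) : ℂ)) (by fun_prop)
  have h2 := hlim (fun x => (φ x : ℂ)) (by fun_prop)
  -- Applying `R` shifts the orbit by one step, so the difference of averages telescopes to `O(1 /
  -- N)`; this gives invariance of the limit.
  have h3 : Tendsto (fun N : ℕ => (1 / (N : ℂ)) * ∑ n ∈ Finset.Icc 1 N, (φ (R (R^[n] z)) : ℂ) -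
      (1 / (N : ℂ)) * ∑ n ∈ Finset.Icc 1 N, (φ (R^[n] z) : ℂ)) U (𝓝 0) := by
    have htel : ∀ N : ℕ, (1 / (N : ℂ)) * ∑ n ∈ Finset.Icc 1 N, (φ (R (R^[n] z)) : ℂ) -
        (1 / (N : ℂ)) * ∑ n ∈ Finset.Icc 1 N, (φ (R^[n] z) : ℂ) =
        (1 / (N : ℂ)) * (φ (R^[N + 1] z) - φ (R^[1] z)) := by
      intro N
      rw [← mul_sub]
      congr 1
      induction N with
      | zero => simp
      | succ N ih =>
        rw [Finset.sum_Icc_succ_top (by omega), Finset.sum_Icc_succ_top (by omega)]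
        rw [Function.iterate_succ_apply' R (N + 1)]
        linear_combination ih
    simp only [htel]
    refine Tendsto.mono_left ?_ hU
    refine squeeze_zero_norm (a := fun N : ℕ => (1 / (N : ℝ)) * (2 * ‖φ‖)) (fun N => ?_) ?_
    · rw [norm_mul]
      have e1 : ‖(1 / (N : ℂ))‖ = 1 / (N : ℝ) := by simp
      rw [e1]
      gcongr
      rw [← Complex.ofReal_sub, Complex.norm_real]
      refine (norm_sub_le _ _).trans ?_
      have := φ.norm_coe_le_norm (R^[N + 1] z)
      have := φ.norm_coe_le_norm (R^[1] z)
      linarith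
    · simpa using (tendsto_one_div_atTop_nhds_zero_nat (𝕜 := ℝ)).mul_const (2 * ‖φ‖)
  have h4 := tendsto_nhds_unique (h1.sub h2) h3
  rw [integral_complex_ofReal, integral_complex_ofReal, ← Complex.ofReal_sub] at h4
  exact sub_eq_zero.mp (by exact_mod_cast h4)

/-- The powers of a uniquely ergodic, totally ergodic map are uniquely ergodic. -/
theorem eq_of_measurePreserving_iterate {Y : Type*} [MeasurableSpace Y] {S : Y → Y}
    (hSm : Measurable S) (hue : IsUniquelyErgodic S) {ν : Measure Y} [IsProbabilityMeasure ν]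
    (hν : MeasurePreserving S ν ν) {p : ℕ} (hp : p ≠ 0) (herg : Ergodic S^[p] ν)
    {κ : Measure Y} [IsProbabilityMeasure κ] (hκ : MeasurePreserving S^[p] κ κ) : κ = ν := by
  obtain ⟨p, rfl⟩ := Nat.exists_eq_succ_of_ne_zero hp
  -- This average is `S`-invariant, hence equal to `ν`. Its term `i = 0` shows that `κ` is
  -- absolutely continuous with respect to `ν`, and ergodicity of the power under `ν` then forces
  -- equality.
  let m : Measure Y := ((p + 1 : ℕ) : ENNReal)⁻¹ • ∑ i ∈ Finset.range (p + 1), κ.map S^[i]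
  have hp0 : ((p + 1 : ℕ) : ENNReal) ≠ 0 := by exact_mod_cast p.succ_ne_zero
  have happ : ∀ s, MeasurableSet s →
      m s = ((p + 1 : ℕ) : ENNReal)⁻¹ * ∑ i ∈ Finset.range (p + 1), κ (S^[i] ⁻¹' s) := by
    intro s hs
    simp only [m, Measure.smul_apply, Measure.finsetSum_apply, smul_eq_mul]
    congr 1
    exact Finset.sum_congr rfl fun i _ => Measure.map_apply (hSm.iterate i) hs
  have hm1 : IsProbabilityMeasure m := ⟨by
    rw [happ _ MeasurableSet.univ]
    simp only [Set.preimage_univ, measure_univ, Finset.sum_const, Finset.card_range, nsmul_eq_mul,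
      mul_one]
    exact ENNReal.inv_mul_cancel hp0 (ENNReal.natCast_ne_top _)⟩
  have hm : MeasurePreserving S m m := by
    refine ⟨hSm, Measure.ext fun s hs => ?_⟩
    rw [Measure.map_apply hSm hs, happ s hs, happ _ (hSm hs)]
    congr 1
    have e : ∀ i, S^[i] ⁻¹' (S ⁻¹' s) = S^[i + 1] ⁻¹' s := fun i => by
      rw [← Set.preimage_comp, ← Function.iterate_succ']
    simp only [e]
    rw [Finset.sum_range_succ, Finset.sum_range_succ' (fun i => κ (S^[i] ⁻¹' s)),
      hκ.measure_preimage hs.nullMeasurableSet]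
    simp
  have hmν : m = ν := hue.unique ⟨hm1, hm⟩ ⟨inferInstance, hν⟩
  refine herg.eq_of_absolutelyContinuous hκ (Measure.AbsolutelyContinuous.mk fun s hs h0 => ?_)
  rw [← hmν, happ s hs, mul_eq_zero, Finset.sum_eq_zero_iff] at h0
  have := (h0.resolve_left (ENNReal.inv_ne_zero.mpr (ENNReal.natCast_ne_top _))) 0 (by simp)
  simpa using this

-- If infinitely many `N` violated the bound, an ultrafilter concentrated on them would produce a
-- joining `κ` whose correlation is at least `ε`. Its marginals are invariant under `S^[p]` and
-- `S^[q]`, hence equal to `ν`, and the uniform bound `ε / 2` over joinings is contradicted.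
open Filter Topology in
theorem eventually_norm_sum_mul_conj_le {Y : Type*} [MetricSpace Y] [CompactSpace Y]
    [MeasurableSpace Y] [BorelSpace Y] {S : Y → Y} (hS : Continuous S)
    (hue : IsUniquelyErgodic S) {ν : Measure Y} [IsProbabilityMeasure ν]
    (hν : MeasurePreserving S ν ν) (hqds : HasQuasiDiscreteSpectrum S ν)
    (f : C(Y, ℂ)) (hf : ∫ x, f x ∂ν = 0) (y : Y) {ε : ℝ} (hε : 0 < ε) :
    ∃ K : ℕ, ∀ p q : ℕ, p.Prime → q.Prime → p ≠ q → K < p → K < q → ∀ᶠ N : ℕ in atTop,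
      ‖∑ n ∈ Finset.Icc 1 N, f (S^[p * n] y) * starRingEnd ℂ (f (S^[q * n] y))‖ ≤ ε * N := by
  have hfL : MemLp f 2 ν := MemLp.of_bound f.continuous.aestronglyMeasurable ‖f‖
    (Eventually.of_forall fun x => f.norm_coe_le_norm x)
  have hf0 : inner ℂ ((memLp_const (1 : ℂ)).toLp _ : Lp ℂ 2 ν) (hfL.toLp _) = 0 := by
    rw [L2.inner_def, ← hf]
    refine integral_congr_ae ?_
    filter_upwards [hfL.coeFn_toLp,
      (memLp_const (1 : ℂ) : MemLp (fun _ : Y => (1 : ℂ)) 2 ν).coeFn_toLp] with x h1 h2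
    rw [h1, h2]; simp
  obtain ⟨K, hK⟩ := norm_inner_comp_fst_snd_le hν hqds hf0 (half_pos hε)
  refine ⟨K, fun p q hp hq hne hKp hKq => ?_⟩
  by_contra hcon
  rw [not_eventually] at hcon
  simp only [not_le] at hcon
  have hne' := frequently_iff_neBot.mp hcon
  set U := Ultrafilter.of (atTop ⊓ 𝓟 {N : ℕ | ε * N <
    ‖∑ n ∈ Finset.Icc 1 N, f (S^[p * n] y) * starRingEnd ℂ (f (S^[q * n] y))‖}) with hUdef
  have hU := Ultrafilter.of_le (atTop ⊓ 𝓟 {N : ℕ | ε * N <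
    ‖∑ n ∈ Finset.Icc 1 N, f (S^[p * n] y) * starRingEnd ℂ (f (S^[q * n] y))‖})
  rw [← hUdef] at hU
  have hUtop : (U : Filter ℕ) ≤ atTop := hU.trans inf_le_left
  have hUbad := (hU.trans inf_le_right) (mem_principal_self _)
  obtain ⟨κ, hκ, hR, hlim⟩ := exists_measurePreserving_tendsto_average
    (R := Prod.map S^[p] S^[q]) ((hS.iterate p).prodMap (hS.iterate q)) (y, y) U hUtop
  have h₁ : MeasurePreserving Prod.fst κ ν := by
    refine ⟨measurable_fst, ?_⟩
    have := Measure.isProbabilityMeasure_map (μ := κ) measurable_fst.aemeasurable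
    refine eq_of_measurePreserving_iterate hS.measurable hue hν hp.ne_zero
      (hqds.totallyErgodic p hp.ne_zero) ⟨(hS.iterate p).measurable, ?_⟩
    rw [Measure.map_map (hS.iterate p).measurable measurable_fst]
    conv_rhs => rw [← hR.map_eq, Measure.map_map measurable_fst hR.measurable]
    rfl
  have h₂ : MeasurePreserving Prod.snd κ ν := by
    refine ⟨measurable_snd, ?_⟩
    have := Measure.isProbabilityMeasure_map (μ := κ) measurable_snd.aemeasurable
    refine eq_of_measurePreserving_iterate hS.measurable hue hν hq.ne_zero
      (hqds.totallyErgodic q hq.ne_zero) ⟨(hS.iterate q).measurable, ?_⟩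
    rw [Measure.map_map (hS.iterate q).measurable measurable_snd]
    conv_rhs => rw [← hR.map_eq, Measure.map_map measurable_snd hR.measurable]
    rfl
  have hle := hK p q hp hq hne hKp hKq κ hκ hR h₁ h₂
  have hinner : inner ℂ (Lp.compMeasurePreservingₗᵢ ℂ _ h₂ (hfL.toLp _))
      (Lp.compMeasurePreservingₗᵢ ℂ _ h₁ (hfL.toLp _)) =
      ∫ z, f z.1 * starRingEnd ℂ (f z.2) ∂κ := by
    rw [L2.inner_def]
    refine integral_congr_ae ?_
    filter_upwards [Lp.coeFn_compMeasurePreserving (hfL.toLp _) h₁,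
      Lp.coeFn_compMeasurePreserving (hfL.toLp _) h₂,
      h₁.quasiMeasurePreserving.ae hfL.coeFn_toLp,
      h₂.quasiMeasurePreserving.ae hfL.coeFn_toLp] with z e1 e2 e3 e4
    change inner ℂ ((Lp.compMeasurePreserving _ h₂ (hfL.toLp _) : Lp ℂ 2 κ) z)
      ((Lp.compMeasurePreserving _ h₁ (hfL.toLp _) : Lp ℂ 2 κ) z) = _
    rw [e1, e2, Function.comp_apply, Function.comp_apply, e3, e4]
    rfl
  rw [hinner] at hle
  have hiter : ∀ n, (Prod.map S^[p] S^[q])^[n] (y, y) = (S^[p * n] y, S^[q * n] y) := by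
    intro n
    rw [Prod.map_iterate, Prod.map_apply, ← Function.iterate_mul, ← Function.iterate_mul]
  have hl := (hlim (fun z => f z.1 * starRingEnd ℂ (f z.2)) (by fun_prop)).norm
  simp only [hiter] at hl
  have hge : ε ≤ ‖∫ z, f z.1 * starRingEnd ℂ (f z.2) ∂κ‖ := by
    refine ge_of_tendsto hl ?_
    filter_upwards [hUbad, hUtop (eventually_ne_atTop 0)] with N hN hN0
    have hN0' : (0 : ℝ) < N := by positivity
    rw [norm_mul, norm_div, norm_one, Complex.norm_natCast, div_mul_eq_mul_div, one_mul,
      le_div_iff₀ hN0']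
    exact le_of_lt hN
  linarith

/-! ### The Turán–Kubilius inequality and the orthogonality criterion -/

theorem sum_Icc_ite_dvd (g : ℕ → ℂ) {p : ℕ} (hp : 0 < p) (N : ℕ) :
    ∑ n ∈ Finset.Icc 1 N, (if p ∣ n then g n else 0) = ∑ m ∈ Finset.Icc 1 (N / p), g (p * m) := by
  rw [← Finset.sum_filter]
  symm
  refine Finset.sum_bij' (fun m _ => p * m) (fun n _ => n / p) ?_ ?_ ?_ ?_ ?_
  · intro m hm
    simp only [Finset.mem_filter, Finset.mem_Icc] at hm ⊢
    refine ⟨⟨Nat.mul_pos hp hm.1, ?_⟩, dvd_mul_right _ _⟩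
    rw [mul_comm]; exact (Nat.le_div_iff_mul_le hp).mp hm.2
  · intro n hn
    simp only [Finset.mem_filter, Finset.mem_Icc] at hn ⊢
    exact ⟨Nat.div_pos (Nat.le_of_dvd hn.1.1 hn.2) hp, Nat.div_le_div_right hn.1.2⟩
  · intro m _
    exact Nat.mul_div_cancel_left m hp
  · intro n hn
    exact Nat.mul_div_cancel' (Finset.mem_filter.mp hn).2
  · intros; rfl

theorem sum_Icc_ite_dvd_one (d N : ℕ) :
    ∑ n ∈ Finset.Icc 1 N, (if d ∣ n then (1 : ℝ) else 0) = ((N / d : ℕ) : ℝ) := by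
  rw [← Finset.sum_filter, Finset.sum_const, nsmul_eq_mul, mul_one, ← Nat.Ioc_filter_dvd_card_eq_div]
  rfl

/-- The Turán–Kubilius inequality for a finite set of primes. -/
theorem sum_sq_card_prime_divisors_sub_le {P : Finset ℕ} (hP : ∀ p ∈ P, p.Prime) (N : ℕ) :
    ∑ n ∈ Finset.Icc 1 N,
      (∑ p ∈ P, (if p ∣ n then (1 : ℝ) else 0) - ∑ p ∈ P, (1 / p : ℝ)) ^ 2 ≤
      (N + 2 * P.card) * ∑ p ∈ P, (1 / p : ℝ) := by
  set A := ∑ p ∈ P, (1 / p : ℝ) with hA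
  have hA0 : 0 ≤ A := Finset.sum_nonneg fun p _ => by positivity
  set w : ℕ → ℝ := fun n => ∑ p ∈ P, (if p ∣ n then (1 : ℝ) else 0) with hw
  have h1 : (N : ℝ) * A - P.card ≤ ∑ n ∈ Finset.Icc 1 N, w n := by
    simp only [hw]
    rw [Finset.sum_comm]
    simp only [sum_Icc_ite_dvd_one]
    have : (P.card : ℝ) = ∑ p ∈ P, (1 : ℝ) := by simp
    rw [hA, Finset.mul_sum, this, ← Finset.sum_sub_distrib]
    refine Finset.sum_le_sum fun p _ => ?_
    have := Nat.lt_floor_add_one ((N : ℝ) / p)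
    rw [Nat.floor_div_eq_div] at this
    rw [mul_one_div]; linarith
  have h2 : ∑ n ∈ Finset.Icc 1 N, w n ^ 2 ≤ N * A ^ 2 + N * A := by
    have e : ∀ n, w n ^ 2 = ∑ p ∈ P, ∑ q ∈ P,
        (if p ∣ n then (1 : ℝ) else 0) * (if q ∣ n then (1 : ℝ) else 0) := by
      intro n; rw [sq, hw, Finset.sum_mul_sum]
    simp only [e]
    rw [Finset.sum_comm]
    have hb : ∀ p ∈ P, ∀ q ∈ P, ∑ n ∈ Finset.Icc 1 N,
        (if p ∣ n then (1 : ℝ) else 0) * (if q ∣ n then (1 : ℝ) else 0) ≤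
        N * ((1 / p) * (1 / q)) + if p = q then N * (1 / p : ℝ) else 0 := by
      intro p hp q hq
      by_cases hpq : p = q
      · subst hpq
        simp only [mul_ite, mul_one, mul_zero, if_true]
        rw [Finset.sum_congr rfl fun n _ => show (if p ∣ n then (if p ∣ n then (1 : ℝ) else 0) else 0)
          = if p ∣ n then (1 : ℝ) else 0 by split_ifs <;> rfl, sum_Icc_ite_dvd_one]
        refine Nat.cast_div_le.trans ?_
        rw [div_eq_mul_one_div]
        exact le_add_of_nonneg_left (by positivity)
      · rw [if_neg hpq, add_zero]
        have hcop := (Nat.coprime_primes (hP p hp) (hP q hq)).mpr hpq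
        have hiff : ∀ n, (if p ∣ n then (1 : ℝ) else 0) * (if q ∣ n then (1 : ℝ) else 0) =
            if p * q ∣ n then (1 : ℝ) else 0 := fun n => by
          have : p * q ∣ n ↔ p ∣ n ∧ q ∣ n :=
            ⟨fun h => ⟨dvd_of_mul_right_dvd h, dvd_of_mul_left_dvd h⟩,
              fun h => hcop.mul_dvd_of_dvd_of_dvd h.1 h.2⟩
          by_cases h1 : p ∣ n <;> by_cases h2 : q ∣ n <;> simp [this, h1, h2]
        simp only [hiff, sum_Icc_ite_dvd_one]
        refine Nat.cast_div_le.trans (le_of_eq ?_)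
        push_cast
        rw [one_div_mul_one_div, mul_one_div]
    rw [Finset.sum_congr rfl fun p _ => Finset.sum_comm]
    calc _ ≤ ∑ p ∈ P, ∑ q ∈ P,
          ((N : ℝ) * ((1 / p) * (1 / q)) + if p = q then N * (1 / p : ℝ) else 0) :=
          Finset.sum_le_sum fun p hp => Finset.sum_le_sum fun q hq => hb p hp q hq
      _ = N * A ^ 2 + N * A := by
          simp only [Finset.sum_add_distrib, ← Finset.mul_sum, ← Finset.sum_mul]
          rw [sq, hA, Finset.mul_sum P _ (N : ℝ)]
          congr 1
          refine Finset.sum_congr rfl fun p hp => ?_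
          rw [Finset.sum_ite_eq, if_pos hp]
  have h3 : ∑ n ∈ Finset.Icc 1 N, (w n - A) ^ 2 =
      ∑ n ∈ Finset.Icc 1 N, w n ^ 2 - 2 * A * ∑ n ∈ Finset.Icc 1 N, w n + N * A ^ 2 := by
    have : (N : ℝ) * A ^ 2 = ∑ n ∈ Finset.Icc 1 N, A ^ 2 := by simp
    rw [this, Finset.mul_sum, ← Finset.sum_sub_distrib, ← Finset.sum_add_distrib]
    exact Finset.sum_congr rfl fun n _ => by ring
  rw [h3]
  -- The terms `N * A ^ 2` cancel; the rounding loss `P.card` in `h1`, multiplied by `2 * A`, is the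
  -- secondary term.
  nlinarith

/-- Cauchy–Schwarz in `m` removes the unknown weights `u`. Expanding the square leaves the pair
correlations: at most `δ ^ 2 * X` off the diagonal and `X` on it. Completing the square bounds the
root of `δ ^ 2 * n ^ 2 + n` by `δ * n + 1 / (2 * δ)`. -/
theorem norm_sum_mul_sum_le {ι κ : Type*} (P : Finset ι) (s : Finset κ) (u : κ → ℂ)
    (w : ι → κ → ℂ) {X δ : ℝ} (hX : (s.card : ℝ) ≤ X) (hδ : 0 < δ) (hu : ∀ m, ‖u m‖ ≤ 1)
    (hw : ∀ p m, ‖w p m‖ ≤ 1)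
    (hcor : ∀ p ∈ P, ∀ q ∈ P, p ≠ q → ‖∑ m ∈ s, w p m * starRingEnd ℂ (w q m)‖ ≤ δ ^ 2 * X) :
    ‖∑ m ∈ s, u m * ∑ p ∈ P, w p m‖ ≤ X * (δ * P.card + 1 / (2 * δ)) := by
  classical
  have hX0 : 0 ≤ X := (Nat.cast_nonneg _).trans hX
  have h1 : ‖∑ m ∈ s, u m * ∑ p ∈ P, w p m‖ ≤ ∑ m ∈ s, ‖∑ p ∈ P, w p m‖ :=
    norm_sum_le_of_le s fun m _ => by
      rw [norm_mul]; exact mul_le_of_le_one_left (norm_nonneg _) (hu m)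
  have h2 : (∑ m ∈ s, ‖∑ p ∈ P, w p m‖) ^ 2 ≤ X * ∑ m ∈ s, ‖∑ p ∈ P, w p m‖ ^ 2 :=
    sq_sum_le_card_mul_sum_sq.trans
      (mul_le_mul_of_nonneg_right hX (Finset.sum_nonneg fun _ _ => by positivity))
  have h3 : ((∑ m ∈ s, ‖∑ p ∈ P, w p m‖ ^ 2 : ℝ) : ℂ) =
      ∑ p ∈ P, ∑ q ∈ P, ∑ m ∈ s, w p m * starRingEnd ℂ (w q m) := by
    push_cast
    rw [Finset.sum_congr rfl fun p _ => Finset.sum_comm, Finset.sum_comm]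
    refine Finset.sum_congr rfl fun m _ => ?_
    rw [← Complex.mul_conj', map_sum, Finset.sum_mul_sum]
  have h4 : ∑ m ∈ s, ‖∑ p ∈ P, w p m‖ ^ 2 ≤ X * (δ ^ 2 * P.card ^ 2 + P.card) := by
    have h0 : 0 ≤ ∑ m ∈ s, ‖∑ p ∈ P, w p m‖ ^ 2 := Finset.sum_nonneg fun _ _ => by positivity
    rw [← abs_of_nonneg h0, ← Real.norm_eq_abs, ← Complex.norm_real, h3]
    calc _ ≤ ∑ p ∈ P, ∑ q ∈ P, (δ ^ 2 * X + if p = q then X else 0) := by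
          refine norm_sum_le_of_le _ fun p hp => norm_sum_le_of_le _ fun q hq => ?_
          split_ifs with hpq
          · subst hpq
            refine (norm_sum_le_of_le s (f := fun m => w p m * starRingEnd ℂ (w p m))
              (n := fun _ => (1 : ℝ)) fun m _ => ?_).trans ?_
            · rw [norm_mul, RCLike.norm_conj]
              exact mul_le_one₀ (hw p m) (norm_nonneg _) (hw p m)
            · rw [Finset.sum_const, nsmul_eq_mul, mul_one]
              have : 0 ≤ δ ^ 2 * X := by positivity
              linarith
          · rw [add_zero]; exact hcor p hp q hq hpq
      _ = X * (δ ^ 2 * P.card ^ 2 + P.card) := by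
          simp only [Finset.sum_add_distrib, Finset.sum_const, nsmul_eq_mul]
          rw [Finset.sum_congr rfl fun p hp => by rw [Finset.sum_ite_eq, if_pos hp]]
          simp only [Finset.sum_const, nsmul_eq_mul]
          ring
  refine h1.trans (abs_le_of_sq_le_sq' ?_ (by positivity)).2
  refine h2.trans ((mul_le_mul_of_nonneg_left h4 hX0).trans ?_)
  have : (X * (δ * P.card + 1 / (2 * δ))) ^ 2 =
      X * (X * (δ ^ 2 * P.card ^ 2 + P.card)) + X ^ 2 * (1 / (2 * δ)) ^ 2 := by
    field_simp; ring
  rw [this]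
  exact le_add_of_nonneg_right (by positivity)

/-- There are finite sets of large primes with an arbitrarily large sum of reciprocals. -/
theorem exists_primes_sum_one_div_ge (K : ℕ) (B : ℝ) :
    ∃ P : Finset ℕ, (∀ p ∈ P, p.Prime ∧ K < p) ∧ B ≤ ∑ p ∈ P, (1 / p : ℝ) := by
  by_contra! hcon
  have hns : ¬ Summable (Set.indicator {p : ℕ | p.Prime} (fun n : ℕ => (1 : ℝ) / n)) :=
    not_summable_one_div_on_primes
  rw [← summable_nat_add_iff (K + 1)] at hns
  refine hns (summable_of_sum_le (c := B) (fun n => Set.indicator_nonneg (fun _ _ => by positivity) _)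
    fun s => ?_)
  classical
  have h := hcon ((s.map (addRightEmbedding (K + 1))).filter Nat.Prime) fun p hp => by
    simp only [Finset.mem_filter, Finset.mem_map, addRightEmbedding_apply] at hp
    obtain ⟨⟨a, -, rfl⟩, hp⟩ := hp
    exact ⟨hp, by omega⟩
  rw [Finset.sum_filter, Finset.sum_map] at h
  refine le_of_eq_of_le (Finset.sum_congr rfl fun n _ => ?_) h.le
  simp [Set.indicator_apply]

theorem sum_Icc_ite_le (g : ℕ → ℂ) {M L : ℕ} (h : M ≤ L) :
    ∑ m ∈ Finset.Icc 1 L, (if m ≤ M then g m else 0) = ∑ m ∈ Finset.Icc 1 M, g m := by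
  rw [← Finset.sum_filter]
  refine Finset.sum_congr (Finset.ext fun m => ?_) fun _ _ => rfl
  simp only [Finset.mem_filter, Finset.mem_Icc]
  omega

/-- A bilinear sum over a set of integers `p ∈ [B, ∞)`. -/
theorem norm_sum_sum_mul_le_of_block {u F : ℕ → ℂ} (hu : ∀ n, ‖u n‖ ≤ 1) (hF : ∀ n, ‖F n‖ ≤ 1)
    {P : Finset ℕ} {B N : ℕ} (hB : 0 < B) (hP : ∀ p ∈ P, B ≤ p) {δ : ℝ} (hδ : 0 < δ)
    (hcor : ∀ p ∈ P, ∀ q ∈ P, p ≠ q →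
      ‖∑ m ∈ Finset.Icc 1 (min (N / p) (N / q)), F (p * m) * starRingEnd ℂ (F (q * m))‖ ≤
        δ ^ 2 * (min (N / p) (N / q) : ℕ)) :
    ‖∑ p ∈ P, ∑ m ∈ Finset.Icc 1 (N / p), F (p * m) * (u p * u m)‖ ≤
      (N / B : ℝ) * (δ * P.card + 1 / (2 * δ)) := by
  have hdiv : ∀ p ∈ P, N / p ≤ N / B := fun p hp => Nat.div_le_div_left (hP p hp) hB
  have hBN : ((N / B : ℕ) : ℝ) ≤ N / B := Nat.cast_div_le
  -- The cutoff in `w` gives all `p` the common range `m ≤ N / B`, as Cauchy–Schwarz needs; the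
  -- factor `u p` is absorbed into `w`.
  have hmain := norm_sum_mul_sum_le P (Finset.Icc 1 (N / B)) u
    (fun p m => if m ≤ N / p then F (p * m) * u p else 0) (X := N / B) (δ := δ)
    (by simpa using hBN) hδ hu ?_ ?_
  · refine le_of_eq_of_le (congrArg norm ?_) hmain
    simp only [Finset.mul_sum]
    rw [Finset.sum_comm]
    refine Finset.sum_congr rfl fun p hp => ?_
    rw [← sum_Icc_ite_le _ (hdiv p hp)]
    refine Finset.sum_congr rfl fun m _ => ?_
    split_ifs
    · ring
    · ring
  · intro p m
    split_ifs
    · rw [norm_mul]; exact mul_le_one₀ (hF _) (norm_nonneg _) (hu _)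
    · simp
  · intro p hp q hq hpq
    have e : ∀ m, (if m ≤ N / p then F (p * m) * u p else 0) *
        starRingEnd ℂ (if m ≤ N / q then F (q * m) * u q else 0) =
        if m ≤ min (N / p) (N / q) then
          (u p * starRingEnd ℂ (u q)) * (F (p * m) * starRingEnd ℂ (F (q * m))) else 0 := by
      intro m
      by_cases h1 : m ≤ N / p <;> by_cases h2 : m ≤ N / q <;> simp [h1, h2]
      ring
    simp only [e]
    rw [sum_Icc_ite_le _ ((min_le_left _ _).trans (hdiv p hp)), ← Finset.mul_sum, norm_mul, norm_mul,
      RCLike.norm_conj]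
    have h1 : ‖u p‖ * ‖u q‖ ≤ 1 := mul_le_one₀ (hu _) (norm_nonneg _) (hu _)
    refine (mul_le_of_le_one_left (norm_nonneg _) h1).trans ((hcor p hp q hq hpq).trans ?_)
    gcongr
    refine le_trans ?_ hBN
    exact_mod_cast (min_le_left _ _).trans (hdiv p hp)

/-- In the block of `j` one has `p < 2 ^ (j + 1)`, so each element counts for at most `2 / p`. -/
theorem sum_card_log_fiber_le (P : Finset ℕ) (hP : ∀ p ∈ P, p ≠ 0) :
    ∑ j ∈ P.image (Nat.log 2), ((P.filter fun p => Nat.log 2 p = j).card : ℝ) / 2 ^ j ≤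
      2 * ∑ p ∈ P, (1 / p : ℝ) := by
  rw [← Finset.sum_fiberwise_of_maps_to (s := P) (t := P.image (Nat.log 2)) (g := Nat.log 2)
    (fun p hp => Finset.mem_image_of_mem _ hp) fun p => (1 / p : ℝ), Finset.mul_sum]
  refine Finset.sum_le_sum fun j _ => ?_
  rw [Finset.card_eq_sum_ones, Nat.cast_sum, Finset.sum_div, Finset.mul_sum]
  refine Finset.sum_le_sum fun p hp => ?_
  obtain ⟨hpP, rfl⟩ := Finset.mem_filter.mp hp
  have hp0 : (0 : ℝ) < p := by exact_mod_cast Nat.pos_of_ne_zero (hP p hpP)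
  have h1 : (p : ℝ) ≤ 2 ^ Nat.log 2 p * 2 := by
    exact_mod_cast (Nat.lt_pow_succ_log_self one_lt_two p).le
  rw [Nat.cast_one, mul_one_div, div_le_div_iff₀ (by positivity) hp0]
  linarith

theorem sum_one_div_two_pow_le (s : Finset ℕ) : ∑ j ∈ s, (1 : ℝ) / 2 ^ j ≤ 2 := by
  have h := summable_geometric_two.sum_le_tsum s fun _ _ => by positivity
  rw [tsum_geometric_two] at h
  simpa using h

/-- The bilinear sum over a finite set of primes, split into dyadic blocks. -/
theorem norm_sum_sum_mul_le {u F : ℕ → ℂ} (hu : ∀ n, ‖u n‖ ≤ 1) (hF : ∀ n, ‖F n‖ ≤ 1)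
    {P : Finset ℕ} {N : ℕ} (hP : ∀ p ∈ P, p ≠ 0) {δ : ℝ} (hδ : 0 < δ)
    (hcor : ∀ p ∈ P, ∀ q ∈ P, p ≠ q →
      ‖∑ m ∈ Finset.Icc 1 (min (N / p) (N / q)), F (p * m) * starRingEnd ℂ (F (q * m))‖ ≤
        δ ^ 2 * (min (N / p) (N / q) : ℕ)) :
    ‖∑ p ∈ P, ∑ m ∈ Finset.Icc 1 (N / p), F (p * m) * (u p * u m)‖ ≤
      N * (2 * δ * ∑ p ∈ P, (1 / p : ℝ) + 1 / δ) := by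
  rw [← Finset.sum_fiberwise_of_maps_to (s := P) (t := P.image (Nat.log 2)) (g := Nat.log 2)
    (fun p hp => Finset.mem_image_of_mem _ hp)
    fun p => ∑ m ∈ Finset.Icc 1 (N / p), F (p * m) * (u p * u m)]
  calc _ ≤ ∑ j ∈ P.image (Nat.log 2), ((N / (2 ^ j : ℕ) : ℝ) *
        (δ * (P.filter fun p => Nat.log 2 p = j).card + 1 / (2 * δ))) := by
        refine norm_sum_le_of_le _ fun j _ => ?_
        refine norm_sum_sum_mul_le_of_block hu hF (by positivity) (fun p hp => ?_) hδ ?_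
        · obtain ⟨hpP, rfl⟩ := Finset.mem_filter.mp hp
          exact Nat.pow_log_le_self 2 (hP p hpP)
        · intro p hp q hq
          exact hcor p (Finset.mem_filter.mp hp).1 q (Finset.mem_filter.mp hq).1
    _ = N * (δ * ∑ j ∈ P.image (Nat.log 2), ((P.filter fun p => Nat.log 2 p = j).card : ℝ) / 2 ^ j
        + 1 / (2 * δ) * ∑ j ∈ P.image (Nat.log 2), (1 : ℝ) / 2 ^ j) := by
        rw [Finset.mul_sum, Finset.mul_sum, ← Finset.sum_add_distrib, Finset.mul_sum]
        refine Finset.sum_congr rfl fun j _ => ?_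
        push_cast; ring
    _ ≤ N * (δ * (2 * ∑ p ∈ P, (1 / p : ℝ)) + 1 / (2 * δ) * 2) := by
        gcongr
        · exact sum_card_log_fiber_le P hP
        · exact sum_one_div_two_pow_le _
    _ = _ := by field_simp

open Filter Topology in
/-- The Kátai–Bourgain–Sarnak–Ziegler orthogonality criterion. -/
theorem tendsto_average_mul_of_isMultiplicative {u : ArithmeticFunction ℂ}
    (hmul : u.IsMultiplicative) (hu : ∀ n, ‖u n‖ ≤ 1) {F : ℕ → ℂ} (hF : ∀ n, ‖F n‖ ≤ 1)
    (h : ∀ ε : ℝ, 0 < ε → ∃ K : ℕ, ∀ p q : ℕ, p.Prime → q.Prime → p ≠ q → K < p → K < q →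
      ∀ᶠ N : ℕ in atTop,
        ‖∑ n ∈ Finset.Icc 1 N, F (p * n) * starRingEnd ℂ (F (q * n))‖ ≤ ε * N) :
    Tendsto (fun N : ℕ => (1 / (N : ℂ)) * ∑ n ∈ Finset.Icc 1 N, F n * u n) atTop (𝓝 0) := by
  have key : ∀ δ : ℝ, 0 < δ → ∀ᶠ N : ℕ in atTop,
      ‖∑ n ∈ Finset.Icc 1 N, F n * u n‖ ≤ 6 * δ * N := by
    intro δ hδ
    obtain ⟨K, hK⟩ := h (δ ^ 2) (by positivity)
    -- The size `2 / δ ^ 2` of the reciprocal sum makes the Turán–Kubilius error and the term `1 /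
    -- δ` at most `δ * A` relative to `N`; primes above `1 / δ` make the multiples of `p ^ 2`
    -- negligible.
    obtain ⟨P, hP, hA⟩ := exists_primes_sum_one_div_ge (max K ⌈1 / δ⌉₊) (2 / δ ^ 2)
    set A := ∑ p ∈ P, (1 / p : ℝ) with hAdef
    have hPK : ∀ p ∈ P, K < p := fun p hp => (le_max_left _ _).trans_lt (hP p hp).2
    have hPδ : ∀ p ∈ P, (1 : ℝ) / p ≤ δ := by
      intro p hp
      have h1 : 1 / δ ≤ p := (Nat.le_ceil _).trans
        (by exact_mod_cast ((le_max_right _ _).trans_lt (hP p hp).2).le)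
      have h2 : (0 : ℝ) < p := by exact_mod_cast (hP p hp).1.pos
      rw [div_le_iff₀ hδ] at h1
      rw [div_le_iff₀ h2]; linarith
    have hA2 : 2 ≤ δ ^ 2 * A := by
      rw [div_le_iff₀ (by positivity)] at hA; linarith
    have hApos : 0 < A := lt_of_lt_of_le (by positivity) hA
    have hcor : ∀ᶠ N : ℕ in atTop, ∀ p ∈ P, ∀ q ∈ P, p ≠ q →
        ‖∑ m ∈ Finset.Icc 1 (min (N / p) (N / q)), F (p * m) * starRingEnd ℂ (F (q * m))‖ ≤
          δ ^ 2 * (min (N / p) (N / q) : ℕ) := by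
      refine (eventually_all_finset P).mpr fun p hp => (eventually_all_finset P).mpr fun q hq => ?_
      by_cases hpq : p = q
      · exact Eventually.of_forall fun N hne => absurd hpq hne
      · have ht : Tendsto (fun N : ℕ => min (N / p) (N / q)) atTop atTop :=
          tendsto_atTop.mpr fun b =>
            ((tendsto_atTop.mp (Nat.tendsto_div_const_atTop (hP p hp).1.ne_zero) b).and
              (tendsto_atTop.mp (Nat.tendsto_div_const_atTop (hP q hq).1.ne_zero) b)).mono
              fun N hN => le_min hN.1 hN.2
        exact (ht.eventually (hK p q (hP p hp).1 (hP q hq).1 hpq (hPK p hp) (hPK q hq))).mono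
          fun N hN _ => hN
    filter_upwards [hcor, eventually_ge_atTop (2 * P.card)] with N hN hNP
    have hNP' : 2 * (P.card : ℝ) ≤ N := by exact_mod_cast hNP
    set a : ℕ → ℂ := fun n => F n * u n with ha
    have ha1 : ∀ n, ‖a n‖ ≤ 1 := fun n => by
      rw [ha, norm_mul]; exact mul_le_one₀ (hF n) (norm_nonneg _) (hu n)
    set w : ℕ → ℝ := fun n => ∑ p ∈ P, (if p ∣ n then (1 : ℝ) else 0) with hw
    -- The number `w n` of prime divisors in `P` is close to `A` on average, so `A` times the sum of
    -- `a` may be replaced by a sum over multiples of the primes in `P`.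
    have hE1 : ‖∑ n ∈ Finset.Icc 1 N, ((w n : ℂ) - A) * a n‖ ≤ N * (δ * A) := by
      have h1 : ‖∑ n ∈ Finset.Icc 1 N, ((w n : ℂ) - A) * a n‖ ≤ ∑ n ∈ Finset.Icc 1 N, |w n - A| :=
        norm_sum_le_of_le _ fun n _ => by
          rw [norm_mul, ← Complex.ofReal_sub, Complex.norm_real, Real.norm_eq_abs]
          exact mul_le_of_le_one_right (abs_nonneg _) (ha1 n)
      refine h1.trans (abs_le_of_sq_le_sq' ?_ (by positivity)).2
      refine sq_sum_le_card_mul_sum_sq.trans ?_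
      simp only [sq_abs, Nat.card_Icc, add_tsub_cancel_right]
      have htk := sum_sq_card_prime_divisors_sub_le (fun p hp => (hP p hp).1) N
      calc _ ≤ (N : ℝ) * ((N + 2 * P.card) * A) := by gcongr
        _ ≤ (N : ℝ) * ((N + N) * A) := by gcongr
        _ = N ^ 2 * A * 2 := by ring
        _ ≤ N ^ 2 * A * (δ ^ 2 * A) := by gcongr
        _ = _ := by ring
    have hT : ∑ n ∈ Finset.Icc 1 N, (w n : ℂ) * a n =
        ∑ p ∈ P, ∑ m ∈ Finset.Icc 1 (N / p), a (p * m) := by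
      rw [← Finset.sum_congr rfl fun p hp => sum_Icc_ite_dvd a (hP p hp).1.pos N, Finset.sum_comm]
      refine Finset.sum_congr rfl fun n _ => ?_
      simp only [hw, Complex.ofReal_sum, Finset.sum_mul]
      refine Finset.sum_congr rfl fun p _ => ?_
      split_ifs <;> simp
    -- Multiplicativity on coprime arguments can fail only when `p ∣ m`, that is for at most `N / p
    -- ^ 2` values of `m`.
    have hE2 : ‖∑ p ∈ P, ∑ m ∈ Finset.Icc 1 (N / p), a (p * m) -
        ∑ p ∈ P, ∑ m ∈ Finset.Icc 1 (N / p), F (p * m) * (u p * u m)‖ ≤ N * (2 * δ * A) := by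
      rw [← Finset.sum_sub_distrib]
      calc _ ≤ ∑ p ∈ P, N * (2 * δ * (1 / p : ℝ)) := by
            refine norm_sum_le_of_le _ fun p hp => ?_
            rw [← Finset.sum_sub_distrib]
            refine (norm_sum_le_of_le _ (n := fun m => 2 * if p ∣ m then (1 : ℝ) else 0)
              fun m _ => ?_).trans ?_
            · simp only [ha]
              split_ifs with hpm
              · rw [← mul_sub, norm_mul]
                have h1 : ‖u (p * m) - u p * u m‖ ≤ 2 := by
                  refine (norm_sub_le _ _).trans ?_
                  rw [norm_mul]
                  have := mul_le_one₀ (hu p) (norm_nonneg (u m)) (hu m)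
                  linarith [hu (p * m)]
                have := mul_le_mul (hF (p * m)) h1 (norm_nonneg _) zero_le_one
                linarith
              · rw [hmul.map_mul_of_coprime ((Nat.Prime.coprime_iff_not_dvd (hP p hp).1).mpr hpm)]
                simp
            · rw [← Finset.mul_sum, sum_Icc_ite_dvd_one]
              have h1 : ((N / p / p : ℕ) : ℝ) ≤ N * (1 / p) * (1 / p) := by
                refine Nat.cast_div_le.trans ?_
                rw [div_eq_mul_one_div]
                gcongr
                rw [mul_one_div]
                exact Nat.cast_div_le
              have h2 : (N : ℝ) * (1 / p) * (1 / p) ≤ N * (1 / p) * δ := by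
                gcongr
                exact hPδ p hp
              linarith
        _ = _ := by rw [← Finset.mul_sum, ← Finset.mul_sum]
    have hE3 := norm_sum_sum_mul_le (u := u) hu hF (fun p hp => (hP p hp).1.ne_zero) hδ hN
    have hsplit : (A : ℂ) * ∑ n ∈ Finset.Icc 1 N, a n =
        -∑ n ∈ Finset.Icc 1 N, ((w n : ℂ) - A) * a n +
        ((∑ p ∈ P, ∑ m ∈ Finset.Icc 1 (N / p), a (p * m) -
          ∑ p ∈ P, ∑ m ∈ Finset.Icc 1 (N / p), F (p * m) * (u p * u m)) +
        ∑ p ∈ P, ∑ m ∈ Finset.Icc 1 (N / p), F (p * m) * (u p * u m)) := by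
      rw [sub_add_cancel, ← hT, Finset.mul_sum, ← Finset.sum_neg_distrib, ← Finset.sum_add_distrib]
      exact Finset.sum_congr rfl fun n _ => by ring
    have hnorm : A * ‖∑ n ∈ Finset.Icc 1 N, a n‖ ≤ N * (δ * A) + (N * (2 * δ * A) +
        N * (2 * δ * A + 1 / δ)) := by
      have : A * ‖∑ n ∈ Finset.Icc 1 N, a n‖ = ‖(A : ℂ) * ∑ n ∈ Finset.Icc 1 N, a n‖ := by
        rw [norm_mul, Complex.norm_real, Real.norm_eq_abs, abs_of_pos hApos]
      rw [this, hsplit]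
      refine (norm_add_le _ _).trans (add_le_add (by rwa [norm_neg]) ?_)
      exact (norm_add_le _ _).trans (add_le_add hE2 hE3)
    have hδA : 1 / δ ≤ δ * A := by
      rw [div_le_iff₀ hδ]; nlinarith
    refine le_of_mul_le_mul_left ?_ hApos
    have : (N : ℝ) * (1 / δ) ≤ N * (δ * A) := by gcongr
    nlinarith
  rw [Metric.tendsto_nhds]
  intro ε hε
  filter_upwards [key (ε / 12) (by positivity), eventually_gt_atTop 0] with N hN hN0
  have hN0' : (0 : ℝ) < N := by exact_mod_cast hN0
  rw [dist_zero_right, norm_mul, norm_div, norm_one, Complex.norm_natCast, div_mul_eq_mul_div,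
    one_mul, div_lt_iff₀ hN0']
  nlinarith

/-! ### A Tauberian theorem by Fourier kernels -/

section Tauberian

open Filter Topology Complex
open scoped FourierTransform ContDiff SchwartzMap

/-- An integrable kernel of mass one with compactly supported Fourier transform. -/
theorem exists_fourier_kernel : ∃ φ K : ℝ → ℂ, Continuous φ ∧ HasCompactSupport φ ∧
    (∀ v, K v = ∫ t, cexp (↑(-2 * Real.pi * t * v) * I) * φ t) ∧ Integrable K ∧
    Integrable (fun w => |w| * ‖K w‖) ∧ ∫ w, K w = 1 := by
  let b : ContDiffBump (0 : ℝ) := default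
  have hc : HasCompactSupport (fun t => (b t : ℂ)) := b.hasCompactSupport.comp_left Complex.ofReal_zero
  have hs : ContDiff ℝ ∞ (fun t => (b t : ℂ)) := Complex.ofRealCLM.contDiff.comp b.contDiff
  let φ : 𝓢(ℝ, ℂ) := hc.toSchwartzMap hs
  refine ⟨φ, (𝓕 φ : 𝓢(ℝ, ℂ)), φ.continuous, hc, fun v => ?_, (𝓕 φ).integrable, ?_, ?_⟩
  · rw [SchwartzMap.fourier_coe, Real.fourier_real_eq_integral_exp_smul]
    rfl
  · have h := (𝓕 φ : 𝓢(ℝ, ℂ)).integrable_pow_mul volume 1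
    simp only [pow_one, Real.norm_eq_abs] at h
    exact h
  · have h1 : (𝓕⁻ (𝓕 φ)) (0 : ℝ) = φ 0 := by rw [FourierTransform.fourierInv_fourier_eq]
    rw [SchwartzMap.fourierInv_coe, Real.fourierInv_eq] at h1
    simp only [inner_zero_right, AddChar.map_zero_eq_one, one_smul] at h1
    rw [h1]
    change ((b 0 : ℝ) : ℂ) = 1
    rw [b.one_of_mem_closedBall (Metric.mem_closedBall_self b.rIn_pos.le), ofReal_one]

variable {f : ℝ → ℂ}

theorem integrable_mul_exp_neg (hfm : Measurable f) (hf1 : ∀ u, ‖f u‖ ≤ 1) (hf0 : ∀ u < 0, f u = 0)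
    {σ : ℝ} (hσ : 0 < σ) : Integrable fun u : ℝ => f u * cexp (-(σ * u)) := by
  have h1 : IntegrableOn (fun u : ℝ => Real.exp (-σ * u)) (Set.Ici 0) :=
    (integrableOn_Ici_iff_integrableOn_Ioi).mpr (exp_neg_integrableOn_Ioi 0 hσ)
  have h2 := (integrable_indicator_iff measurableSet_Ici).mpr h1
  refine h2.mono' (by fun_prop) (Eventually.of_forall fun u => ?_)
  by_cases hu : u < 0
  · rw [hf0 u hu, zero_mul, norm_zero]
    exact Set.indicator_nonneg (fun _ _ => (Real.exp_pos _).le) _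
  · rw [Set.indicator_of_mem (by simpa using hu), norm_mul, Complex.norm_exp]
    have : (-((σ : ℂ) * u)).re = -σ * u := by simp
    rw [this]
    exact mul_le_of_le_one_left (Real.exp_pos _).le (hf1 u)

/-- Fubini, after inserting the Fourier representation of `K`: the damping `σ` makes the double
integral absolutely convergent, and the inner integral becomes the Laplace transform on the line `Re
z = σ`. -/
theorem integral_mul_exp_neg_mul_kernel {φ K : ℝ → ℂ} (hφ : Continuous φ)
    (hφc : HasCompactSupport φ)
    (hK : ∀ v, K v = ∫ t, cexp (↑(-2 * Real.pi * t * v) * I) * φ t)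
    (hfm : Measurable f) (hf1 : ∀ u, ‖f u‖ ≤ 1) (hf0 : ∀ u < 0, f u = 0) {σ : ℝ} (hσ : 0 < σ)
    (T x : ℝ) :
    ∫ u : ℝ, f u * cexp (-(σ * u)) * K (T * (u - x)) =
      ∫ t : ℝ, cexp (↑(2 * Real.pi * t * (T * x)) * I) *
        (φ t * ∫ u : ℝ, f u * cexp (-((σ + ↑(2 * Real.pi * t * T) * I) * u))) := by
  have hint := (integrable_mul_exp_neg hfm hf1 hf0 hσ).mul_prod
    (hφ.integrable_of_hasCompactSupport hφc (μ := volume))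
  have hint2 : Integrable (Function.uncurry fun u t : ℝ => f u * cexp (-(σ * u)) *
      (cexp (↑(-2 * Real.pi * t * (T * (u - x))) * I) * φ t)) (volume.prod volume) := by
    refine hint.mono ?_ (Eventually.of_forall fun z => ?_)
    · refine Measurable.aestronglyMeasurable ?_
      simp only [Function.uncurry_def]
      fun_prop
    · simp only [Function.uncurry_def, norm_mul, Complex.norm_exp_ofReal_mul_I, one_mul, le_refl]
  simp only [hK, ← integral_const_mul]
  rw [integral_integral_swap hint2]
  refine integral_congr_ae (Eventually.of_forall fun t => integral_congr_ae
    (Eventually.of_forall fun u => ?_))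
  have e : cexp (-(σ * u)) * cexp (↑(-2 * Real.pi * t * (T * (u - x))) * I) =
      cexp (↑(2 * Real.pi * t * (T * x)) * I) *
        cexp (-((σ + ↑(2 * Real.pi * t * T) * I) * u)) := by
    rw [← Complex.exp_add, ← Complex.exp_add]
    congr 1
    push_cast; ring
  dsimp only
  linear_combination f u * φ t * e

/-- The limit `σ → 0+` of the damped identity. Since `φ` has compact support, only a bounded piece
of the boundary line enters, so continuity of `G` up to that line gives domination. -/
theorem integral_mul_kernel {φ K : ℝ → ℂ} (hφ : Continuous φ) (hφc : HasCompactSupport φ)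
    (hK : ∀ v, K v = ∫ t, cexp (↑(-2 * Real.pi * t * v) * I) * φ t) (hKi : Integrable K)
    (hfm : Measurable f) (hf1 : ∀ u, ‖f u‖ ≤ 1) (hf0 : ∀ u < 0, f u = 0) {G : ℂ → ℂ}
    (hG : ContinuousOn G {z | 0 ≤ z.re})
    (hlap : ∀ z : ℂ, 0 < z.re → ∫ u : ℝ, f u * cexp (-(z * u)) = G z) {T : ℝ} (hT : 0 < T) (x : ℝ) :
    ∫ u : ℝ, f u * K (T * (u - x)) =
      ∫ t : ℝ, cexp (↑(2 * Real.pi * t * (T * x)) * I) *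
        (φ t * G (↑(2 * Real.pi * t * T) * I)) := by
  have hKT : Integrable fun u : ℝ => K (T * (u - x)) :=
    (hKi.comp_mul_left' hT.ne').comp_sub_right x
  have hleft : Tendsto (fun σ : ℝ => ∫ u : ℝ, f u * cexp (-(σ * u)) * K (T * (u - x))) (𝓝[>] 0)
      (𝓝 (∫ u : ℝ, f u * K (T * (u - x)))) := by
    refine tendsto_integral_filter_of_dominated_convergence (fun u => ‖K (T * (u - x))‖)
      (Eventually.of_forall fun σ => ?_) ?_ hKT.norm (Eventually.of_forall fun u => ?_)
    · exact (Measurable.aestronglyMeasurable (by fun_prop)).mul hKT.aestronglyMeasurable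
    · filter_upwards [self_mem_nhdsWithin] with σ hσ
      refine Eventually.of_forall fun u => ?_
      rw [norm_mul]
      refine mul_le_of_le_one_left (norm_nonneg _) ?_
      by_cases hu : u < 0
      · rw [hf0 u hu, zero_mul, norm_zero]; exact zero_le_one
      · rw [norm_mul, Complex.norm_exp]
        have : (-((σ : ℂ) * u)).re = -(σ * u) := by simp
        rw [this]
        refine mul_le_one₀ (hf1 u) (Real.exp_pos _).le (Real.exp_le_one_iff.mpr ?_)
        have : 0 ≤ σ * u := mul_nonneg (le_of_lt hσ) (not_lt.mp hu)
        linarith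
    · have : Tendsto (fun σ : ℝ => f u * cexp (-(σ * u)) * K (T * (u - x))) (𝓝 0)
          (𝓝 (f u * cexp (-((0 : ℝ) * u)) * K (T * (u - x)))) :=
        Continuous.tendsto (by fun_prop) 0
      simpa using this.mono_left nhdsWithin_le_nhds
  obtain ⟨C, hC⟩ : ∃ C, ∀ σ ∈ Set.Icc (0 : ℝ) 1, ∀ t ∈ tsupport φ,
      ‖G (σ + ↑(2 * Real.pi * t * T) * I)‖ ≤ C := by
    have hcomp : IsCompact (Set.Icc (0 : ℝ) 1 ×ˢ tsupport φ) := isCompact_Icc.prod hφc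
    obtain ⟨C, hC⟩ := hcomp.exists_bound_of_continuousOn
      (f := fun z : ℝ × ℝ => G (z.1 + ↑(2 * Real.pi * z.2 * T) * I))
      (hG.comp (by fun_prop) fun z hz => by simpa using hz.1.1)
    exact ⟨C, fun σ hσ t ht => hC (σ, t) ⟨hσ, ht⟩⟩
  have hright : Tendsto (fun σ : ℝ => ∫ t : ℝ, cexp (↑(2 * Real.pi * t * (T * x)) * I) *
      (φ t * G (σ + ↑(2 * Real.pi * t * T) * I))) (𝓝[>] 0)
      (𝓝 (∫ t : ℝ, cexp (↑(2 * Real.pi * t * (T * x)) * I) *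
        (φ t * G (↑(2 * Real.pi * t * T) * I)))) := by
    refine tendsto_integral_filter_of_dominated_convergence (fun t => ‖φ t‖ * C) ?_ ?_
      ((hφ.integrable_of_hasCompactSupport hφc).norm.mul_const C)
      (Eventually.of_forall fun t => ?_)
    · filter_upwards [self_mem_nhdsWithin] with σ hσ
      have hσpos : (0 : ℝ) < σ := hσ
      refine Continuous.aestronglyMeasurable ?_
      have : Continuous fun t : ℝ => G (σ + ↑(2 * Real.pi * t * T) * I) :=
        hG.comp_continuous (by fun_prop) fun t => by simpa using hσpos.le
      exact Continuous.mul (by fun_prop) (hφ.mul this)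
    · filter_upwards [Ioo_mem_nhdsGT (zero_lt_one' ℝ)] with σ hσ
      refine Eventually.of_forall fun t => ?_
      rw [norm_mul, Complex.norm_exp_ofReal_mul_I, one_mul, norm_mul]
      by_cases ht : t ∈ tsupport φ
      · exact mul_le_mul_of_nonneg_left (hC σ ⟨hσ.1.le, hσ.2.le⟩ t ht) (norm_nonneg _)
      · rw [image_eq_zero_of_notMem_tsupport ht]; simp
    · refine Tendsto.const_mul _ (Tendsto.const_mul _ ?_)
      have h1 : ContinuousWithinAt G {z | 0 ≤ z.re} (↑(2 * Real.pi * t * T) * I) :=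
        hG _ (by simp)
      refine h1.tendsto.comp (tendsto_nhdsWithin_iff.mpr ⟨?_, ?_⟩)
      · have : Tendsto (fun σ : ℝ => (σ : ℂ) + ↑(2 * Real.pi * t * T) * I) (𝓝 0)
            (𝓝 (((0 : ℝ) : ℂ) + ↑(2 * Real.pi * t * T) * I)) := Continuous.tendsto (by fun_prop) 0
        rw [Complex.ofReal_zero, zero_add] at this
        exact this.mono_left nhdsWithin_le_nhds
      · filter_upwards [self_mem_nhdsWithin] with σ hσ
        have hσpos : (0 : ℝ) < σ := hσ
        simpa using hσpos.le
  refine tendsto_nhds_unique hleft (hright.congr' ?_)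
  filter_upwards [self_mem_nhdsWithin] with σ hσ
  have hσpos : (0 : ℝ) < σ := hσ
  rw [integral_mul_exp_neg_mul_kernel hφ hφc hK hfm hf1 hf0 hσpos]
  refine integral_congr_ae (Eventually.of_forall fun t => ?_)
  dsimp only
  rw [hlap]
  simpa using hσpos

/-- A Tauberian theorem for slowly oscillating functions whose Laplace transform extends
continuously to the closed half plane. -/
theorem tendsto_zero_of_laplace_continuousOn (hfm : Measurable f) (hf1 : ∀ u, ‖f u‖ ≤ 1)
    (hf0 : ∀ u < 0, f u = 0) {G : ℂ → ℂ} (hG : ContinuousOn G {z | 0 ≤ z.re})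
    (hlap : ∀ z : ℂ, 0 < z.re → ∫ u : ℝ, f u * cexp (-(z * u)) = G z)
    (hosc : ∀ x, 1 ≤ x → ∀ u, ‖f u - f x‖ ≤ 2 * |u - x| + Real.exp (-x)) :
    Tendsto f atTop (𝓝 0) := by
  obtain ⟨φ, K, hφ, hφc, hK, hKi, hKw, hK1⟩ := exists_fourier_kernel
  set C₀ := ∫ w, ‖K w‖
  set C₁ := ∫ w, |w| * ‖K w‖
  have hC₁ : 0 ≤ C₁ := integral_nonneg fun w => by positivity
  -- Slow oscillation compares `f x` with its kernel average at scale `1 / T`. For fixed `T` that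
  -- average tends to zero by the Riemann–Lebesgue lemma, and `T` is taken large beforehand.
  have hbound : ∀ T : ℝ, 0 < T → ∀ x : ℝ, 1 ≤ x →
      ‖f x‖ ≤ 2 / T * C₁ + Real.exp (-x) * C₀ + T * ‖∫ u : ℝ, f u * K (T * (u - x))‖ := by
    intro T hT x hx
    have hk : ∫ u : ℝ, f u * K (T * (u - x)) = (T⁻¹ : ℝ) • ∫ w : ℝ, f (x + w / T) * K w := by
      have h1 := Measure.integral_comp_mul_left (fun w : ℝ => f (x + w / T) * K w) T
      rw [abs_of_pos (inv_pos.mpr hT)] at h1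
      rw [← h1, ← integral_sub_right_eq_self (fun u : ℝ => f (x + T * u / T) * K (T * u)) x]
      refine integral_congr_ae (Eventually.of_forall fun u => ?_)
      dsimp only
      rw [mul_div_cancel_left₀ _ hT.ne', add_sub_cancel]
    have hfi : Integrable fun w : ℝ => f (x + w / T) * K w :=
      hKi.bdd_mul (c := 1) (Measurable.aestronglyMeasurable (by fun_prop))
        (Eventually.of_forall fun w => hf1 _)
    have hsplit : f x = -(∫ w : ℝ, (f (x + w / T) - f x) * K w) + ∫ w : ℝ, f (x + w / T) * K w := by
      simp only [sub_mul]
      rw [integral_sub hfi (hKi.const_mul _), integral_const_mul, hK1]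
      ring
    have h2 : ‖∫ w : ℝ, (f (x + w / T) - f x) * K w‖ ≤ 2 / T * C₁ + Real.exp (-x) * C₀ := by
      rw [← integral_const_mul, ← integral_const_mul,
        ← integral_add (hKw.const_mul _) (hKi.norm.const_mul _)]
      refine norm_integral_le_of_norm_le ((hKw.const_mul _).add (hKi.norm.const_mul _))
        (Eventually.of_forall fun w => ?_)
      rw [norm_mul]
      have h3 := hosc x hx (x + w / T)
      rw [add_sub_cancel_left, abs_div, abs_of_pos hT] at h3
      refine (mul_le_mul_of_nonneg_right h3 (norm_nonneg _)).trans (le_of_eq ?_)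
      ring
    have h4 : ‖∫ w : ℝ, f (x + w / T) * K w‖ = T * ‖∫ u : ℝ, f u * K (T * (u - x))‖ := by
      rw [hk, norm_smul, Real.norm_eq_abs, abs_of_pos (inv_pos.mpr hT), mul_inv_cancel_left₀ hT.ne']
    rw [← h4]
    conv_lhs => rw [hsplit]
    exact (norm_add_le _ _).trans (by rw [norm_neg]; gcongr)
  have hRL : ∀ T : ℝ, 0 < T →
      Tendsto (fun x : ℝ => ∫ u : ℝ, f u * K (T * (u - x))) atTop (𝓝 0) := by
    intro T hT
    have h1 := Real.zero_at_infty_fourier fun t : ℝ => φ t * G (↑(2 * Real.pi * t * T) * I)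
    have h2 : Tendsto (fun x : ℝ => -(T * x)) atTop (cocompact ℝ) :=
      (tendsto_neg_atTop_atBot.comp (tendsto_id.const_mul_atTop hT)).mono_right
        atBot_le_cocompact
    refine (h1.comp h2).congr fun x => ?_
    rw [integral_mul_kernel hφ hφc hK hKi hfm hf1 hf0 hG hlap hT, Function.comp_apply,
      Real.fourier_real_eq_integral_exp_smul]
    refine integral_congr_ae (Eventually.of_forall fun t => ?_)
    dsimp only
    rw [smul_eq_mul]
    congr 4
    ring
  rw [Metric.tendsto_nhds]
  intro ε hε
  -- Any `T` above `2 * C₁ / ε` would do; adding one keeps `T` positive if `C₁ = 0`.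
  set T := 6 * (C₁ + 1) / ε with hTdef
  have hT : 0 < T := by positivity
  have hlim : Tendsto (fun x : ℝ => 2 / T * C₁ + Real.exp (-x) * C₀ +
      T * ‖∫ u : ℝ, f u * K (T * (u - x))‖) atTop (𝓝 (2 / T * C₁ + 0 * C₀ + T * ‖(0 : ℂ)‖)) :=
    (tendsto_const_nhds.add
      ((Real.tendsto_exp_atBot.comp tendsto_neg_atTop_atBot).mul_const C₀)).add
      ((hRL T hT).norm.const_mul T)
  have hlt : 2 / T * C₁ + 0 * C₀ + T * ‖(0 : ℂ)‖ < ε := by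
    rw [norm_zero, mul_zero, zero_mul, add_zero, add_zero, hTdef]
    rw [div_div_eq_mul_div, div_mul_eq_mul_div, div_lt_iff₀ (by positivity)]
    nlinarith
  filter_upwards [hlim.eventually (gt_mem_nhds hlt), eventually_ge_atTop 1] with x h1 h2
  rw [dist_zero_right]
  exact (hbound T hT x h2).trans_lt h1

end Tauberian

/-! ### The Möbius function has mean zero -/

section Moebius

open Filter Topology Complex
open scoped ArithmeticFunction.Moebius

/-- `z / ((1 + z) * ζ̃ (1 + z))`, where `ζ̃ s = (s - 1) * ζ s`; it equals `1 / (s * ζ s)` at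
`s = 1 + z` for `z ≠ 0`. -/
noncomputable def invZetaExtension (z : ℂ) : ℂ :=
  z / ((1 + z) * Function.update (fun s => (s - 1) * riemannZeta s) 1 1 (1 + z))

/-- The simple pole of `ζ` at `1`, with residue one, makes the updated function continuous there;
elsewhere on the closed half plane the denominator is nonzero because `ζ` has no zeros with `1 ≤ Re
s`. -/
theorem continuousOn_invZetaExtension : ContinuousOn invZetaExtension {z | 0 ≤ z.re} := by
  intro z hz
  have hzre : 0 ≤ z.re := hz
  have hcont : Continuous (Function.update (fun s => (s - 1) * riemannZeta s) 1 1) := by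
    rw [continuous_iff_continuousAt]
    intro s
    rcases eq_or_ne s 1 with rfl | hs
    · exact continuousAt_update_same.mpr riemannZeta_residue_one
    · rw [continuousAt_update_of_ne hs]
      exact (continuousAt_id.sub continuousAt_const).mul
        (differentiableAt_riemannZeta hs).continuousAt
  refine ContinuousAt.continuousWithinAt ?_
  refine ContinuousAt.div continuousAt_id (Continuous.continuousAt (by fun_prop)) ?_
  refine mul_ne_zero (fun h => ?_) ?_
  · have := congrArg Complex.re h
    simp at this
    linarith
  · rcases eq_or_ne z 0 with rfl | h0
    · simp
    · rw [Function.update_of_ne (by simpa using h0)]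
      refine mul_ne_zero (by simpa using h0) (riemannZeta_ne_zero_of_one_le_re ?_)
      simpa using hzre

/-- The summatory function of the Möbius function in exponential scale, normalized. -/
noncomputable def scaledMertens (u : ℝ) : ℂ :=
  if u < 0 then 0 else (∑ k ∈ Finset.Icc 1 ⌊Real.exp u⌋₊, (μ k : ℂ)) * Real.exp (-u)

theorem norm_moebius_le_one (k : ℕ) : ‖(μ k : ℂ)‖ ≤ 1 := by
  rw [Complex.norm_intCast]
  exact_mod_cast ArithmeticFunction.abs_moebius_le_one

theorem measurable_scaledMertens : Measurable scaledMertens := by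
  unfold scaledMertens
  refine Measurable.ite measurableSet_Iio measurable_const (Measurable.mul ?_ (by fun_prop))
  exact (measurable_from_nat (f := fun n : ℕ => ∑ k ∈ Finset.Icc 1 n, (μ k : ℂ))).comp
    (Nat.measurable_floor.comp Real.measurable_exp)

theorem norm_sum_moebius_le (n : ℕ) : ‖∑ k ∈ Finset.Icc 1 n, (μ k : ℂ)‖ ≤ n := by
  refine (norm_sum_le_of_le _ fun k _ => norm_moebius_le_one k).trans ?_
  simp

theorem norm_scaledMertens_le_one (u : ℝ) : ‖scaledMertens u‖ ≤ 1 := by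
  unfold scaledMertens
  split_ifs
  · simp
  · rw [norm_mul, Complex.norm_real, Real.norm_eq_abs, abs_of_pos (Real.exp_pos _)]
    calc _ ≤ Real.exp u * Real.exp (-u) := by
          gcongr
          exact (norm_sum_moebius_le _).trans (Nat.floor_le (Real.exp_pos u).le)
      _ = 1 := by rw [← Real.exp_add]; simp

/-- The new terms number at most `exp b - exp a + 1`, and renormalizing the old sum costs `exp a *
(exp (-a) - exp (-b))`. After scaling, each contributes `1 - exp (a - b) ≤ b - a`, and the extra `1`
becomes `exp (-b)`. -/
theorem norm_scaledMertens_sub_le {a b : ℝ} (ha : 0 ≤ a) (hab : a ≤ b) :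
    ‖scaledMertens b - scaledMertens a‖ ≤ 2 * (b - a) + Real.exp (-b) := by
  unfold scaledMertens
  rw [if_neg (not_lt.mpr ha), if_neg (not_lt.mpr (ha.trans hab))]
  set m := ⌊Real.exp a⌋₊
  set n := ⌊Real.exp b⌋₊
  have hmn : m ≤ n := Nat.floor_le_floor (Real.exp_le_exp.mpr hab)
  have h1 : ‖∑ k ∈ Finset.Icc 1 n, (μ k : ℂ) - ∑ k ∈ Finset.Icc 1 m, (μ k : ℂ)‖ ≤ n - m := by
    have hsub : Finset.Icc 1 m ⊆ Finset.Icc 1 n := Finset.Icc_subset_Icc_right hmn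
    rw [← Finset.sum_sdiff hsub, add_sub_cancel_right]
    refine (norm_sum_le_of_le _ fun k _ => norm_moebius_le_one k).trans ?_
    rw [Finset.sum_const, nsmul_eq_mul, mul_one, Finset.card_sdiff_of_subset hsub]
    simp [Nat.cast_sub hmn]
  have h2 : (n : ℝ) ≤ Real.exp b := Nat.floor_le (Real.exp_pos b).le
  have h3 : Real.exp a < m + 1 := Nat.lt_floor_add_one _
  have h4 : (m : ℝ) ≤ Real.exp a := Nat.floor_le (Real.exp_pos a).le
  have hba : Real.exp a * Real.exp (-b) = Real.exp (a - b) := by rw [← Real.exp_add]; ring_nf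
  have hbb : Real.exp b * Real.exp (-b) = 1 := by rw [← Real.exp_add]; simp
  have haa : Real.exp a * Real.exp (-a) = 1 := by rw [← Real.exp_add]; simp
  have hlin : 1 - Real.exp (a - b) ≤ b - a := by linarith [Real.add_one_le_exp (a - b)]
  have hmono : Real.exp (-b) ≤ Real.exp (-a) := Real.exp_le_exp.mpr (by linarith)
  have hsplit : (∑ k ∈ Finset.Icc 1 n, (μ k : ℂ)) * Real.exp (-b) -
      (∑ k ∈ Finset.Icc 1 m, (μ k : ℂ)) * Real.exp (-a) =
      (∑ k ∈ Finset.Icc 1 n, (μ k : ℂ) - ∑ k ∈ Finset.Icc 1 m, (μ k : ℂ)) * Real.exp (-b) -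
      (∑ k ∈ Finset.Icc 1 m, (μ k : ℂ)) * ((Real.exp (-a) - Real.exp (-b) : ℝ) : ℂ) := by
    push_cast; ring
  rw [hsplit]
  calc _ ≤ (n - m) * Real.exp (-b) + m * (Real.exp (-a) - Real.exp (-b)) := by
        refine (norm_sub_le _ _).trans (add_le_add ?_ ?_)
        · rw [norm_mul, Complex.norm_real, Real.norm_eq_abs, abs_of_pos (Real.exp_pos _)]
          gcongr
        · rw [norm_mul, Complex.norm_real, Real.norm_eq_abs, abs_of_nonneg (by linarith)]
          refine mul_le_mul_of_nonneg_right (norm_sum_moebius_le m) (by linarith)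
    _ ≤ (Real.exp b - Real.exp a + 1) * Real.exp (-b) +
        Real.exp a * (Real.exp (-a) - Real.exp (-b)) := by
        refine add_le_add (mul_le_mul_of_nonneg_right (by linarith) (Real.exp_pos _).le)
          (mul_le_mul_of_nonneg_right h4 (by linarith))
    _ = 2 * (1 - Real.exp (a - b)) + Real.exp (-b) := by
        linear_combination hbb + haa - 2 * hba
    _ ≤ _ := by linarith

theorem norm_scaledMertens_sub_le_of_one_le {x : ℝ} (hx : 1 ≤ x) (u : ℝ) :
    ‖scaledMertens u - scaledMertens x‖ ≤ 2 * |u - x| + Real.exp (-x) := by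
  -- For `u < 0` the jump at the origin is harmless: then `|u - x| > 1`, while the difference is at
  -- most one.
  rcases lt_or_ge u 0 with hu | hu
  · have h0 : scaledMertens u = 0 := if_pos hu
    rw [h0, zero_sub, norm_neg]
    have := norm_scaledMertens_le_one x
    have h1 : x - u ≤ |u - x| := by rw [abs_sub_comm]; exact le_abs_self _
    linarith [Real.exp_pos (-x)]
  · rcases le_total u x with h | h
    · rw [norm_sub_rev, abs_sub_comm, abs_of_nonneg (sub_nonneg.mpr h)]
      exact norm_scaledMertens_sub_le hu h
    · rw [abs_of_nonneg (sub_nonneg.mpr h)]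
      refine (norm_scaledMertens_sub_le (by linarith) h).trans ?_
      gcongr

/-- Abel summation writes `1 / ζ(s)` as `s` times the Mellin integral of the summatory function of
`μ`; the substitution `t = exp u` with `s = 1 + z` turns this into a Laplace transform. -/
theorem integral_scaledMertens_mul_exp {z : ℂ} (hz : 0 < z.re) :
    ∫ u : ℝ, scaledMertens u * cexp (-(z * u)) = invZetaExtension z := by
  have hs : 1 < (1 + z).re := by simpa using hz
  have hs0 : 1 + z ≠ 0 := fun h => by rw [h] at hs; simp at hs; linarith
  have hz0 : z ≠ 0 := fun h => by rw [h] at hz; simp at hz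
  have hO : (fun n : ℕ => ∑ k ∈ Finset.Icc 1 n, ‖(μ k : ℂ)‖) =O[atTop] fun n => (n : ℝ) ^ (1 : ℝ) := by
    refine Asymptotics.IsBigO.of_bound 1 (Eventually.of_forall fun n => ?_)
    rw [Real.norm_of_nonneg (Finset.sum_nonneg fun _ _ => norm_nonneg _), Real.rpow_one, one_mul,
      Real.norm_natCast]
    exact (Finset.sum_le_sum fun k _ => norm_moebius_le_one k).trans (by simp)
  have hL := LSeries_eq_mul_integral' (fun n => (μ n : ℂ)) zero_le_one hs hO
  have hinv := LSeries_one_mul_Lseries_moebius hs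
  rw [LSeries_one_eq_riemannZeta hs] at hinv
  have himg : Real.exp '' Set.Ioi 0 = Set.Ioi 1 := by
    ext t
    constructor
    · rintro ⟨u, hu, rfl⟩
      exact Real.one_lt_exp_iff.mpr hu
    · intro ht
      exact ⟨Real.log t, Real.log_pos ht, Real.exp_log (zero_lt_one.trans ht)⟩
  have hcv := integral_image_eq_integral_abs_deriv_smul (s := Set.Ioi 0) (f := Real.exp)
    (f' := Real.exp) measurableSet_Ioi (fun x _ => (Real.hasDerivAt_exp x).hasDerivWithinAt)
    Real.exp_injective.injOn
    (fun t : ℝ => (∑ k ∈ Finset.Icc 1 ⌊t⌋₊, (μ k : ℂ)) * (t : ℂ) ^ (-(1 + z + 1)))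
  rw [himg] at hcv
  rw [hcv] at hL
  have hint : ∫ u : ℝ, scaledMertens u * cexp (-(z * u)) =
      ∫ u in Set.Ioi (0 : ℝ), |Real.exp u| • ((∑ k ∈ Finset.Icc 1 ⌊Real.exp u⌋₊, (μ k : ℂ)) *
        ((Real.exp u : ℝ) : ℂ) ^ (-(1 + z + 1))) := by
    rw [← integral_Ici_eq_integral_Ioi, ← integral_indicator measurableSet_Ici]
    refine integral_congr_ae (Eventually.of_forall fun u => ?_)
    dsimp only
    by_cases hu : u < 0
    · rw [Set.indicator_of_notMem (by simpa using hu), scaledMertens, if_pos hu, zero_mul]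
    · rw [Set.indicator_of_mem (by simpa using hu), scaledMertens, if_neg hu,
        abs_of_pos (Real.exp_pos u), Complex.real_smul]
      have e : ((Real.exp (-u) : ℝ) : ℂ) * cexp (-(z * u)) =
          ((Real.exp u : ℝ) : ℂ) * ((Real.exp u : ℝ) : ℂ) ^ (-(1 + z + 1)) := by
        rw [Complex.cpow_def_of_ne_zero (by exact_mod_cast (Real.exp_pos u).ne'),
          ← Complex.ofReal_log (Real.exp_pos u).le, Real.log_exp, Complex.ofReal_exp,
          Complex.ofReal_exp, ← Complex.exp_add, ← Complex.exp_add]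
        congr 1
        push_cast; ring
      linear_combination (∑ k ∈ Finset.Icc 1 ⌊Real.exp u⌋₊, (μ k : ℂ)) * e
  rw [hint, invZetaExtension, Function.update_of_ne (by simpa using hz0), add_sub_cancel_left]
  rw [hL] at hinv
  have hζ : riemannZeta (1 + z) ≠ 0 := left_ne_zero_of_mul_eq_one hinv
  field_simp
  linear_combination hinv

theorem tendsto_average_moebius :
    Tendsto (fun N : ℕ => (1 / (N : ℂ)) * ∑ n ∈ Finset.Icc 1 N, (μ n : ℂ)) atTop (𝓝 0) := by
  have h := tendsto_zero_of_laplace_continuousOn measurable_scaledMertens norm_scaledMertens_le_one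
    (fun u hu => if_pos hu) continuousOn_invZetaExtension
    (fun z hz => integral_scaledMertens_mul_exp hz)
    (fun x hx u => norm_scaledMertens_sub_le_of_one_le hx u)
  refine (h.comp (Real.tendsto_log_atTop.comp tendsto_natCast_atTop_atTop)).congr' ?_
  filter_upwards [eventually_ge_atTop 1] with N hN
  have hN1 : (1 : ℝ) ≤ N := by exact_mod_cast hN
  rw [Function.comp_apply, Function.comp_apply, scaledMertens,
    if_neg (not_lt.mpr (Real.log_nonneg hN1)), Real.exp_neg, Real.exp_log (by linarith),
    Nat.floor_natCast]
  push_cast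
  ring

end Moebius

/-! ### The main theorem -/

theorem theorem1 {Y : Type*} [MetricSpace Y] [CompactSpace Y] [MeasurableSpace Y] [BorelSpace Y]
    (S : Y → Y) (hS : Continuous S) (hue : IsUniquelyErgodic S)
    (ν : Measure Y) [IsProbabilityMeasure ν] (hν : MeasurePreserving S ν ν)
    (hqds : HasQuasiDiscreteSpectrum S ν) :
    (∀ u : ArithmeticFunction ℂ, u.IsMultiplicative → (∀ n, ‖u n‖ ≤ 1) →
      ∀ f : C(Y, ℂ), ∫ x, f x ∂ν = 0 → ∀ y : Y,
        Filter.Tendsto (fun N : ℕ => (1 / (N : ℂ)) * ∑ n ∈ Finset.Icc 1 N, f (S^[n] y) * u n)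
          Filter.atTop (nhds 0)) ∧
    (∀ f : C(Y, ℂ), ∀ y : Y,
        Filter.Tendsto (fun N : ℕ => (1 / (N : ℂ)) *
            ∑ n ∈ Finset.Icc 1 N, f (S^[n] y) * (ArithmeticFunction.moebius n : ℂ))
          Filter.atTop (nhds 0)) := by
  have hfirst : ∀ u : ArithmeticFunction ℂ, u.IsMultiplicative → (∀ n, ‖u n‖ ≤ 1) →
      ∀ f : C(Y, ℂ), ∫ x, f x ∂ν = 0 → ∀ y : Y,
        Filter.Tendsto (fun N : ℕ => (1 / (N : ℂ)) * ∑ n ∈ Finset.Icc 1 N, f (S^[n] y) * u n)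
          Filter.atTop (nhds 0) := by
    intro u hmul hu f hf y
    -- The criterion requires values in the unit disc; dividing by `‖f‖ + 1` also covers `f = 0`.
    set a : ℂ := ((‖f‖ + 1 : ℝ) : ℂ) with ha
    have ha0 : a ≠ 0 := by rw [ha]; exact_mod_cast (by positivity : ‖f‖ + 1 ≠ 0)
    have hna : ‖a‖ = ‖f‖ + 1 := by
      rw [ha, Complex.norm_real, Real.norm_of_nonneg (by positivity)]
    set g : C(Y, ℂ) := a⁻¹ • f with hg
    have hg1 : ∀ x, ‖g x‖ ≤ 1 := fun x => by
      rw [hg, ContinuousMap.smul_apply, smul_eq_mul, norm_mul, norm_inv, hna,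
        inv_mul_le_iff₀ (by positivity), mul_one]
      linarith [f.norm_coe_le_norm x]
    have hg0 : ∫ x, g x ∂ν = 0 := by
      simp only [hg, ContinuousMap.smul_apply, integral_smul, hf, smul_zero]
    have h := tendsto_average_mul_of_isMultiplicative hmul hu (F := fun n => g (S^[n] y))
      (fun n => hg1 _)
      (fun ε hε => eventually_norm_sum_mul_conj_le hS hue hν hqds g hg0 y hε)
    have h2 := h.const_mul a
    rw [mul_zero] at h2
    refine h2.congr fun N => ?_
    rw [mul_left_comm, Finset.mul_sum]
    congr 1
    refine Finset.sum_congr rfl fun n _ => ?_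
    simp only [hg, ContinuousMap.smul_apply, smul_eq_mul]
    field_simp
  refine ⟨hfirst, fun f y => ?_⟩
  set I := ∫ x, f x ∂ν with hI
  have hint : Integrable f ν := Integrable.of_bound f.continuous.aestronglyMeasurable ‖f‖
    (Filter.Eventually.of_forall fun x => f.norm_coe_le_norm x)
  -- The first part handles `f - I`; the constant `I` is handled by the mean value of `μ`.
  have h1 := hfirst ((ArithmeticFunction.moebius : ArithmeticFunction ℤ) : ArithmeticFunction ℂ)
    ArithmeticFunction.isMultiplicative_moebius.intCast
    (fun n => by rw [ArithmeticFunction.intCoe_apply]; exact norm_moebius_le_one n)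
    (f - ContinuousMap.const Y I)
    (by
      simp only [ContinuousMap.sub_apply, ContinuousMap.const_apply]
      rw [integral_sub hint (integrable_const _)]
      simp [hI]) y
  have h2 := h1.add (tendsto_average_moebius.const_mul I)
  rw [mul_zero, add_zero] at h2
  refine h2.congr fun N => ?_
  rw [mul_left_comm, ← mul_add, Finset.mul_sum, ← Finset.sum_add_distrib]
  congr 1
  refine Finset.sum_congr rfl fun n _ => ?_
  simp only [ContinuousMap.sub_apply, ContinuousMap.const_apply, ArithmeticFunction.intCoe_apply]
  ring
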